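/- Let $n\ge 2$. A density matrix is a positive semidefinite complex $n\times n$ matrix of trace one. Let $\rho_d$ be a generic density matrix, i.e. one with $n$ distinct eigenvalues. Let $\mathcal{M}$ be the set of all density matrices with the same spectrum as $\rho_d$ (counted with multiplicity), and let $J:\mathcal{M}\to\mathbb{R}$, $J(\rho)=\operatorname{Tr}(\rho\rho_d)$. Then $\mathcal{M}$ is compact, homeomorphic to the flag manifold $\mathbb{U}(n)/(\mathbb{U}(1)\times\cdots\times\mathbb{U}(1))$ ($n$ factors, the diagonal unitary matrices), and a smoothly embedded submanifold of dimension $n^2-n$ of the real vector space of complex $n\times n$ matrices. With respect to every smooth structure of dimension $n^2-n$ on $\mathcal{M}$ (with the subspace topology) that makes the inclusion a smooth embedding, the following holds. 1. $J$ is a Morse function on $\mathcal{M}$: it is smooth, and the Hessian at each of its critical points is nondegenerate. 2. $J$ has exactly $n!$ critical points. Whenever $\rho_d=U\operatorname{diag}(w_1,\dots,w_n)U^\dagger$ with $U$ unitary and $w_k\in\mathbb{R}$, the critical points are the matrices $U\operatorname{diag}(w_{\tau(1)},\dots,w_{\tau(n)})U^\dagger$ for the permutations $\tau$ of $\{1,\dots,n\}$,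 and these are pairwise distinct. 3. There are two different critical points $\rho_{\max}$ and $\rho_{\min}$ such that $J(\rho)<J(\rho_{\max})$ for all $\rho\in\mathcal{M}\setminus\{\rho_{\max}\}$ and $J(\rho)>J(\rho_{\min})$ for all $\rho\in\mathcal{M}\setminus\{\rho_{\min}\}$. Every other critical point $\rho_0$ is a saddle (a nondegenerate critical point at which the Hessian takes both positive and negative values) and satisfies $J(\rho_{\min})<J(\rho_0)<J(\rho_{\max})$. The number of saddles is exactly $n!-2$. -/

import Mathlib

open Matrix Manifold
open scoped Manifold ContDiff ComplexOrder Matrix.Norms.L2Operator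

/-- A density matrix: positive semidefinite (in particular Hermitian) with unit trace. -/
structure IsDensityMatrix {n : ℕ} (ρ : Matrix (Fin n) (Fin n) ℂ) : Prop where
  posSemidef : ρ.PosSemidef
  trace_eq_one : ρ.trace = 1

/-- A generic state: a density matrix with `n` distinct eigenvalues. -/
structure IsGenericState {n : ℕ} (ρ : Matrix (Fin n) (Fin n) ℂ) : Prop where
  isDensityMatrix : IsDensityMatrix ρ
  ncard_spectrum : (spectrum ℂ ρ).ncard = n

/-- The density matrices that have the same eigenvalues as `ρd`, with the same multiplicities. -/
def isospectralSet {n : ℕ} (ρd : Matrix (Fin n) (Fin n) ℂ) : Set (Matrix (Fin n) (Fin n) ℂ) :=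
  {ρ | IsDensityMatrix ρ ∧ ρ.charpoly.roots = ρd.charpoly.roots}

/-- The function `ρ ↦ Tr (ρ ρd)` on the isospectral set of `ρd`, as a real-valued function;
the trace is real by `coe_overlap`. -/
noncomputable def overlap {n : ℕ} (ρd : Matrix (Fin n) (Fin n) ℂ) (ρ : isospectralSet ρd) : ℝ :=
  ((ρ : Matrix (Fin n) (Fin n) ℂ) * ρd).trace.re

theorem coe_overlap {n : ℕ} {ρd : Matrix (Fin n) (Fin n) ℂ} (hd : IsDensityMatrix ρd)
    (ρ : isospectralSet ρd) :
    (overlap ρd ρ : ℂ) = ((ρ : Matrix (Fin n) (Fin n) ℂ) * ρd).trace := by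
  have h1 : (ρ : Matrix (Fin n) (Fin n) ℂ)ᴴ = ρ := ρ.2.1.posSemidef.isHermitian
  have h2 : ρdᴴ = ρd := hd.posSemidef.isHermitian
  refine Complex.conj_eq_iff_re.mp ?_
  have h3 := Matrix.trace_conjTranspose ((ρ : Matrix (Fin n) (Fin n) ℂ) * ρd)
  rw [Matrix.conjTranspose_mul, h1, h2, Matrix.trace_mul_comm] at h3
  exact h3.symm

/-- The maximal torus `U(1) × ⋯ × U(1)` of diagonal matrices in `U(n)`. -/
def diagonalTorus (n : ℕ) : Subgroup (Matrix.unitaryGroup (Fin n) ℂ) where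
  carrier := {U | (U : Matrix (Fin n) (Fin n) ℂ).IsDiag}
  mul_mem' := fun {a b} (ha : (a : Matrix (Fin n) (Fin n) ℂ).IsDiag)
      (hb : (b : Matrix (Fin n) (Fin n) ℂ).IsDiag) =>
    show ((a : Matrix (Fin n) (Fin n) ℂ) * (b : Matrix (Fin n) (Fin n) ℂ)).IsDiag by
      rw [← ha.diagonal_diag, ← hb.diagonal_diag, Matrix.diagonal_mul_diagonal]
      exact Matrix.isDiag_diagonal _
  one_mem' := Matrix.isDiag_one
  inv_mem' := fun {a} (ha : (a : Matrix (Fin n) (Fin n) ℂ).IsDiag) => ha.conjTranspose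

/-- Critical points of a real function on a `d`-dimensional manifold: the differential vanishes. -/
def IsCriticalPt (d : ℕ) {M : Type*} [TopologicalSpace M]
    [ChartedSpace (EuclideanSpace ℝ (Fin d)) M] (f : M → ℝ) (x : M) : Prop :=
  MDifferentiableAt (𝓡 d) 𝓘(ℝ, ℝ) f x ∧ mfderiv (𝓡 d) 𝓘(ℝ, ℝ) f x = 0

/-- The Hessian of `f` at `x` in the preferred chart around `x`. At a critical point a change of
chart changes it by a linear change of variables only, so that its nondegeneracy and the signs of
its values do not depend on the chart. -/
noncomputable def chartHessian (d : ℕ) {M : Type*} [TopologicalSpace M]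
    [ChartedSpace (EuclideanSpace ℝ (Fin d)) M] (f : M → ℝ) (x : M) :
    EuclideanSpace ℝ (Fin d) →L[ℝ] EuclideanSpace ℝ (Fin d) →L[ℝ] ℝ :=
  fderiv ℝ (fderiv ℝ (f ∘ (extChartAt (𝓡 d) x).symm)) (extChartAt (𝓡 d) x x)

/-- Nondegenerate (hyperbolic) critical points: the Hessian is a nondegenerate bilinear form. -/
def IsNondegenerateCriticalPt (d : ℕ) {M : Type*} [TopologicalSpace M]
    [ChartedSpace (EuclideanSpace ℝ (Fin d)) M] (f : M → ℝ) (x : M) : Prop :=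
  IsCriticalPt d f x ∧
    ∀ v : EuclideanSpace ℝ (Fin d), (∀ w, chartHessian d f x v w = 0) → v = 0

/-- Morse functions: smooth functions all of whose critical points are nondegenerate. -/
def IsMorse (d : ℕ) {M : Type*} [TopologicalSpace M]
    [ChartedSpace (EuclideanSpace ℝ (Fin d)) M] (f : M → ℝ) : Prop :=
  ContMDiff (𝓡 d) 𝓘(ℝ, ℝ) ∞ f ∧ ∀ x, IsCriticalPt d f x → IsNondegenerateCriticalPt d f x

/-- Saddles: nondegenerate critical points whose Hessian is indefinite. -/
def IsSaddle (d : ℕ) {M : Type*} [TopologicalSpace M]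
    [ChartedSpace (EuclideanSpace ℝ (Fin d)) M] (f : M → ℝ) (x : M) : Prop :=
  IsNondegenerateCriticalPt d f x ∧
    (∃ v, 0 < chartHessian d f x v v) ∧ ∃ v, chartHessian d f x v v < 0

/-! Write `ρd = U D U†` with `D = diag(w)` and the `w k` distinct. The isospectral set is the
unitary orbit of `D`, and the stabiliser of `D` consists of the diagonal unitaries. This yields
compactness and the flag manifold.

For `X` skew-Hermitian the commutators `[X, D]` are exactly the Hermitian matrices `Z` with zero
diagonal: dividing the entries of `Z` by `w j - w i` (`divDiff`) recovers an `X`. So `Z ↦ V exp(X) D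
exp(-X) V†` parametrises the orbit near `V D V†`. Adding a transversal part to `D` gives
`flattening`, a map of the ambient space whose derivative at zero is the identity. The inverse
function theorem turns it into a slice chart, because a transversal perturbation smaller than the
gaps between the eigenvalues cannot preserve the spectrum unless it vanishes
(`unitary_conj_flattening_mem_iff`).

For any smooth structure that makes the inclusion an embedding, the parametrization is smooth with
injective derivative, and the dimensions agree, so critical points and Hessians can be read off in
it (`exists_equiv_chartHessian`). The derivative of the overlap at `V D V†` is `Z ↦ Re Tr(Z V†ρdV)`.
It vanishes exactly when `V†ρdV` is diagonal, which means that the point commutes with `ρd` and is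
some `U diag(w ∘ τ) U†`. The second derivative there is `-∑ |Z i j|² (w j - w i) / (w (τ j) - w (τ
i))`. All its off-diagonal coefficients are nonzero, and their signs record which pairs `τ` keeps in
order and which it reverses.

At most one permutation keeps all pairs in order and at most one reverses all of them. A maximum
exists by compactness, and comparison with `τ` composed with transpositions shows that it is of the
first kind; likewise a minimum is of the second kind. At every other critical point both signs
occur. -/

/-! ### Unitary diagonalisation and the isospectral set as a unitary orbit -/

theorem isDiag_of_mul_diagonal_comm {n : ℕ} {w : Fin n → ℝ} (hw : Function.Injective w)
    {A : Matrix (Fin n) (Fin n) ℂ}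
    (h : A * diagonal (fun k => (w k : ℂ)) = diagonal (fun k => (w k : ℂ)) * A) : A.IsDiag := by
  intro i j hij
  have h1 := congrFun (congrFun h i) j
  rw [mul_diagonal, diagonal_mul] at h1
  have h2 : ((w j : ℂ) - w i) * A i j = 0 := by linear_combination h1
  rcases mul_eq_zero.mp h2 with h3 | h3
  · exact absurd (hw (Complex.ofReal_injective (sub_eq_zero.mp h3))).symm hij
  · exact h3

theorem charpoly_unitary_conj {n : ℕ} {V : Matrix (Fin n) (Fin n) ℂ}
    (hV : V ∈ unitaryGroup (Fin n) ℂ) (A : Matrix (Fin n) (Fin n) ℂ) :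
    (V * A * Vᴴ).charpoly = A.charpoly := by
  have h1 : V * Vᴴ = 1 := Matrix.mem_unitaryGroup_iff.mp hV
  have h2 : Vᴴ * V = 1 := Matrix.mem_unitaryGroup_iff'.mp hV
  have h3 := Matrix.charpoly_units_conj ⟨V, Vᴴ, h1, h2⟩ A
  rw [← Matrix.coe_units_inv] at h3
  exact h3

theorem roots_charpoly_diagonal {n : ℕ} (a : Fin n → ℂ) :
    (diagonal a).charpoly.roots = Finset.univ.val.map a := by
  rw [charpoly_diagonal]
  have h := Polynomial.roots_multiset_prod_X_sub_C (Finset.univ.val.map a)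
  rwa [Multiset.map_map] at h

theorem Matrix.IsHermitian.exists_unitary_diagonal {n : ℕ} {ρ : Matrix (Fin n) (Fin n) ℂ}
    (h : ρ.IsHermitian) : ∃ V ∈ unitaryGroup (Fin n) ℂ, ∃ w : Fin n → ℝ,
      ρ = V * diagonal (fun k => (w k : ℂ)) * Vᴴ := by
  refine ⟨h.eigenvectorUnitary, h.eigenvectorUnitary.2, h.eigenvalues, ?_⟩
  have := h.spectral_theorem
  rw [Unitary.conjStarAlgAut_apply] at this
  exact this

/-- Without repetitions in the multiset, choosing for each value of `a` its position in `b` is an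
injective self-map of `Fin n`, hence a permutation. -/
theorem exists_perm_of_map_univ_eq {n : ℕ} {α : Type*} {a b : Fin n → α}
    (hb : Function.Injective b) (h : Finset.univ.val.map a = Finset.univ.val.map b) :
    ∃ τ : Equiv.Perm (Fin n), a = b ∘ τ := by
  have ha : Function.Injective a := by
    have h1 : (Finset.univ.val.map a).Nodup := h ▸ Finset.univ.nodup.map hb
    intro i j hij
    exact (Multiset.nodup_map_iff_inj_on Finset.univ.nodup).mp h1 i (Finset.mem_univ i) j
      (Finset.mem_univ j) hij
  have h2 : ∀ i, ∃ j, b j = a i := by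
    intro i
    have : a i ∈ Finset.univ.val.map b := h ▸ Multiset.mem_map_of_mem a (Finset.mem_univ i)
    obtain ⟨j, -, hj⟩ := Multiset.mem_map.mp this
    exact ⟨j, hj⟩
  choose f hf using h2
  have hfi : Function.Injective f := fun i j hij => ha (by rw [← hf i, ← hf j, hij])
  exact ⟨Equiv.ofBijective f (Finite.injective_iff_bijective.mp hfi), funext fun i => (hf i).symm⟩

theorem exists_perm_of_roots_eq {n : ℕ} {a w : Fin n → ℝ} (hw : Function.Injective w)
    (h : (diagonal (fun k => (a k : ℂ))).charpoly.roots =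
      (diagonal (fun k => (w k : ℂ))).charpoly.roots) :
    ∃ τ : Equiv.Perm (Fin n), a = w ∘ τ := by
  rw [roots_charpoly_diagonal, roots_charpoly_diagonal] at h
  obtain ⟨τ, hτ⟩ := exists_perm_of_map_univ_eq (Complex.ofReal_injective.comp hw) h
  exact ⟨τ, funext fun i => Complex.ofReal_injective (congrFun hτ i)⟩

/-- Permuting the diagonal entries is a unitary conjugation. -/
theorem exists_unitary_diagonal_comp {n : ℕ} (τ : Equiv.Perm (Fin n)) (w : Fin n → ℂ) :
    ∃ P ∈ unitaryGroup (Fin n) ℂ, diagonal (w ∘ τ) = P * diagonal w * Pᴴ := by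
  let P : Matrix (Fin n) (Fin n) ℂ := Matrix.of fun i j => if τ i = j then 1 else 0
  have hP : P * Pᴴ = 1 := by
    ext i j
    simp [P, Matrix.mul_apply, Matrix.one_apply, apply_ite, eq_comm]
  refine ⟨P, Matrix.mem_unitaryGroup_iff.mpr hP, ?_⟩
  ext i j
  rw [Matrix.mul_apply]
  simp [P, Matrix.diagonal_apply, apply_ite]
  grind

theorem unitary_conj_mul_conj {n : ℕ} (V W A : Matrix (Fin n) (Fin n) ℂ) :
    V * (W * A * Wᴴ) * Vᴴ = (V * W) * A * (V * W)ᴴ := by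
  simp only [conjTranspose_mul, Matrix.mul_assoc]

theorem conjTranspose_mem_unitaryGroup {n : ℕ} {V : Matrix (Fin n) (Fin n) ℂ}
    (hV : V ∈ unitaryGroup (Fin n) ℂ) : Vᴴ ∈ unitaryGroup (Fin n) ℂ :=
  Unitary.star_mem hV

theorem unitary_conj_mem_isospectralSet {n : ℕ} {ρd ρ V : Matrix (Fin n) (Fin n) ℂ}
    (hV : V ∈ unitaryGroup (Fin n) ℂ) (h : ρ ∈ isospectralSet ρd) :
    V * ρ * Vᴴ ∈ isospectralSet ρd := by
  refine ⟨⟨h.1.posSemidef.mul_mul_conjTranspose_same V, ?_⟩, ?_⟩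
  · rw [Matrix.trace_mul_cycle, show Vᴴ * V = 1 from Matrix.mem_unitaryGroup_iff'.mp hV,
      Matrix.one_mul, h.1.trace_eq_one]
  · rw [charpoly_unitary_conj hV, h.2]

/-- The spectrum is the range of `w`. It has `n` elements, as many as the index set, which leaves no
room for a repetition. -/
theorem IsGenericState.injective {n : ℕ} {ρd U : Matrix (Fin n) (Fin n) ℂ} {w : Fin n → ℝ}
    (h : IsGenericState ρd) (hU : U ∈ unitaryGroup (Fin n) ℂ)
    (hw : ρd = U * diagonal (fun k => (w k : ℂ)) * Uᴴ) : Function.Injective w := by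
  have h1 : spectrum ℂ ρd = Set.range (fun k => (w k : ℂ)) := by
    ext z
    rw [Matrix.mem_spectrum_iff_isRoot_charpoly, hw, charpoly_unitary_conj hU,
      ← Polynomial.mem_roots (Matrix.charpoly_monic _).ne_zero, roots_charpoly_diagonal]
    simp
  have h2 := h.ncard_spectrum
  rw [h1, ← Set.image_univ] at h2
  have h3 : Set.InjOn (fun k => (w k : ℂ)) Set.univ := by
    apply Set.injOn_of_ncard_image_eq
    · rw [h2, Set.ncard_univ, Nat.card_eq_fintype_card, Fintype.card_fin]
    · exact Set.finite_univ
  intro i j hij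
  exact h3 (Set.mem_univ i) (Set.mem_univ j) (by simp [hij])

section

variable {n : ℕ} {ρd U : Matrix (Fin n) (Fin n) ℂ} {w : Fin n → ℝ}

theorem mem_isospectralSet_self (hd : IsDensityMatrix ρd) : ρd ∈ isospectralSet ρd := ⟨hd, rfl⟩

theorem conj_diagonal_mem_isospectralSet (hd : IsDensityMatrix ρd)
    (hU : U ∈ unitaryGroup (Fin n) ℂ) (hw : ρd = U * diagonal (fun k => (w k : ℂ)) * Uᴴ)
    (τ : Equiv.Perm (Fin n)) {V : Matrix (Fin n) (Fin n) ℂ} (hV : V ∈ unitaryGroup (Fin n) ℂ) :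
    V * diagonal (fun k => (w (τ k) : ℂ)) * Vᴴ ∈ isospectralSet ρd := by
  obtain ⟨P, hP, h⟩ := exists_unitary_diagonal_comp τ (fun k => (w k : ℂ))
  have h1 : diagonal (fun k => (w k : ℂ)) = Uᴴ * ρd * Uᴴᴴ := by
    rw [hw, unitary_conj_mul_conj, show Uᴴ * U = 1 from Matrix.mem_unitaryGroup_iff'.mp hU]
    simp
  have h2 : diagonal (fun k => (w (τ k) : ℂ)) = (P * Uᴴ) * ρd * (P * Uᴴ)ᴴ := by
    rw [← unitary_conj_mul_conj, ← h1, ← h]; rfl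
  rw [h2, unitary_conj_mul_conj]
  exact unitary_conj_mem_isospectralSet
    (mul_mem hV (mul_mem hP (conjTranspose_mem_unitaryGroup hU))) (mem_isospectralSet_self hd)

/-- The characteristic polynomial is invariant under conjugation, so `a` and `w` list the same
roots. -/
theorem exists_perm_of_conj_diagonal_mem (hU : U ∈ unitaryGroup (Fin n) ℂ)
    (hw : ρd = U * diagonal (fun k => (w k : ℂ)) * Uᴴ) (hwi : Function.Injective w)
    {V : Matrix (Fin n) (Fin n) ℂ} (hV : V ∈ unitaryGroup (Fin n) ℂ) {a : Fin n → ℝ}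
    (h : V * diagonal (fun k => (a k : ℂ)) * Vᴴ ∈ isospectralSet ρd) :
    ∃ τ : Equiv.Perm (Fin n), a = w ∘ τ := by
  apply exists_perm_of_roots_eq hwi
  rw [← charpoly_unitary_conj hV, h.2, hw, charpoly_unitary_conj hU]

/-- The spectral theorem gives a diagonal form with the entries of `w` in some order; a permutation
matrix absorbed into the unitary restores the order. -/
theorem exists_unitary_of_mem_isospectralSet (hU : U ∈ unitaryGroup (Fin n) ℂ)
    (hw : ρd = U * diagonal (fun k => (w k : ℂ)) * Uᴴ) (hwi : Function.Injective w)
    {ρ : Matrix (Fin n) (Fin n) ℂ} (h : ρ ∈ isospectralSet ρd) :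
    ∃ V ∈ unitaryGroup (Fin n) ℂ, ρ = V * diagonal (fun k => (w k : ℂ)) * Vᴴ := by
  obtain ⟨V, hV, a, ha⟩ := h.1.posSemidef.isHermitian.exists_unitary_diagonal
  obtain ⟨τ, hτ⟩ := exists_perm_of_conj_diagonal_mem hU hw hwi hV (ha ▸ h)
  obtain ⟨P, hP, h1⟩ := exists_unitary_diagonal_comp τ (fun k => (w k : ℂ))
  refine ⟨V * P, mul_mem hV hP, ?_⟩
  rw [← unitary_conj_mul_conj, ← h1, ha, hτ]
  rfl

end

/-! ### Compactness and the flag manifold -/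

theorem isCompact_unitaryGroup (n : ℕ) :
    IsCompact (unitaryGroup (Fin n) ℂ : Set (Matrix (Fin n) (Fin n) ℂ)) := by
  have : ProperSpace (Matrix (Fin n) (Fin n) ℂ) := FiniteDimensional.proper ℂ _
  refine Metric.isCompact_of_isClosed_isBounded ?_ ?_
  · have : (unitaryGroup (Fin n) ℂ : Set (Matrix (Fin n) (Fin n) ℂ)) =
        {V | V * star V = 1} := by
      ext V; exact Matrix.mem_unitaryGroup_iff
    rw [this]
    exact isClosed_eq (by fun_prop) continuous_const
  · refine (Metric.isBounded_closedBall (x := (0 : Matrix (Fin n) (Fin n) ℂ)) (r := 1)).subset ?_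
    intro V hV
    rw [mem_closedBall_zero_iff]
    -- Unitary elements have norm one only in a nontrivial algebra; the case `n = 0` is separate.
    rcases subsingleton_or_nontrivial (Matrix (Fin n) (Fin n) ℂ) with h | h
    · rw [Subsingleton.elim V 0, norm_zero]; exact zero_le_one
    · exact (CStarRing.norm_of_mem_unitary hV).le

section

variable {n : ℕ} {ρd U : Matrix (Fin n) (Fin n) ℂ} {w : Fin n → ℝ}

theorem isospectralSet_eq_image (hd : IsDensityMatrix ρd)
    (hU : U ∈ unitaryGroup (Fin n) ℂ) (hw : ρd = U * diagonal (fun k => (w k : ℂ)) * Uᴴ)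
    (hwi : Function.Injective w) :
    isospectralSet ρd = (fun V : Matrix (Fin n) (Fin n) ℂ =>
      V * diagonal (fun k => (w k : ℂ)) * Vᴴ) '' unitaryGroup (Fin n) ℂ := by
  ext ρ
  constructor
  · intro h
    obtain ⟨V, hV, h⟩ := exists_unitary_of_mem_isospectralSet hU hw hwi h
    exact ⟨V, hV, h.symm⟩
  · rintro ⟨V, hV, rfl⟩
    exact conj_diagonal_mem_isospectralSet hd hU hw 1 hV

theorem isCompact_isospectralSet (hd : IsDensityMatrix ρd)
    (hU : U ∈ unitaryGroup (Fin n) ℂ) (hw : ρd = U * diagonal (fun k => (w k : ℂ)) * Uᴴ)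
    (hwi : Function.Injective w) : IsCompact (isospectralSet ρd) := by
  rw [isospectralSet_eq_image hd hU hw hwi]
  exact (isCompact_unitaryGroup n).image (by fun_prop)

/-- Equality of the two conjugates says that `Vᴴ * W` commutes with a diagonal matrix with distinct
entries. The fibres of the orbit map are therefore the cosets of the diagonal torus. -/
theorem unitary_conj_diagonal_eq_iff (hwi : Function.Injective w)
    {V W : Matrix (Fin n) (Fin n) ℂ} (hV : V ∈ unitaryGroup (Fin n) ℂ)
    (hW : W ∈ unitaryGroup (Fin n) ℂ) :
    V * diagonal (fun k => (w k : ℂ)) * Vᴴ = W * diagonal (fun k => (w k : ℂ)) * Wᴴ ↔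
      (Vᴴ * W).IsDiag := by
  have hV1 : Vᴴ * V = 1 := Matrix.mem_unitaryGroup_iff'.mp hV
  have hV2 : V * Vᴴ = 1 := Matrix.mem_unitaryGroup_iff.mp hV
  have hW1 : Wᴴ * W = 1 := Matrix.mem_unitaryGroup_iff'.mp hW
  have hW2 : W * Wᴴ = 1 := Matrix.mem_unitaryGroup_iff.mp hW
  set D := diagonal (fun k => (w k : ℂ)) with hD
  constructor
  · intro h
    refine isDiag_of_mul_diagonal_comm hwi ?_
    rw [← hD]
    calc Vᴴ * W * D = Vᴴ * (W * D * Wᴴ) * W := by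
          simp only [Matrix.mul_assoc, hW1, Matrix.mul_one]
      _ = Vᴴ * (V * D * Vᴴ) * W := by rw [h]
      _ = (Vᴴ * V) * D * (Vᴴ * W) := by simp only [Matrix.mul_assoc]
      _ = D * (Vᴴ * W) := by rw [hV1, Matrix.one_mul]
  · intro h
    have h1 : D * (Vᴴ * W) = Vᴴ * W * D := by
      rw [← h.diagonal_diag, hD, diagonal_mul_diagonal, diagonal_mul_diagonal]
      simp only [mul_comm]
    calc V * D * Vᴴ = V * (D * (Vᴴ * W)) * Wᴴ := by
          simp only [Matrix.mul_assoc, hW2, Matrix.mul_one]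
      _ = (V * Vᴴ) * (W * D * Wᴴ) := by rw [h1]; simp only [Matrix.mul_assoc]
      _ = W * D * Wᴴ := by rw [hV2, Matrix.one_mul]

/-- The orbit map descends to a continuous bijection from a compact space to a Hausdorff one. -/
theorem nonempty_homeomorph_isospectralSet (hd : IsDensityMatrix ρd)
    (hU : U ∈ unitaryGroup (Fin n) ℂ) (hw : ρd = U * diagonal (fun k => (w k : ℂ)) * Uᴴ)
    (hwi : Function.Injective w) :
    Nonempty ((Matrix.unitaryGroup (Fin n) ℂ ⧸ diagonalTorus n) ≃ₜ isospectralSet ρd) := by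
  have : CompactSpace (unitaryGroup (Fin n) ℂ) :=
    isCompact_iff_compactSpace.mp (isCompact_unitaryGroup n)
  let f : unitaryGroup (Fin n) ℂ → isospectralSet ρd := fun V =>
    ⟨V * diagonal (fun k => (w k : ℂ)) * (V : Matrix (Fin n) (Fin n) ℂ)ᴴ,
      conj_diagonal_mem_isospectralSet hd hU hw 1 V.2⟩
  have hf : Continuous f := by
    refine Continuous.subtype_mk ?_ _
    exact (continuous_subtype_val.matrix_mul continuous_const).matrix_mul
      continuous_subtype_val.matrix_conjTranspose
  have hrel : ∀ V W : unitaryGroup (Fin n) ℂ, f V = f W ↔ V⁻¹ * W ∈ diagonalTorus n := by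
    intro V W
    rw [Subtype.ext_iff]
    exact unitary_conj_diagonal_eq_iff hwi V.2 W.2
  let g : (unitaryGroup (Fin n) ℂ ⧸ diagonalTorus n) → isospectralSet ρd :=
    Quotient.lift f fun V W h => (hrel V W).mpr (QuotientGroup.leftRel_apply.mp h)
  have hg : Continuous g := hf.quotient_lift _
  have hgb : Function.Bijective g := by
    constructor
    · intro a b
      refine Quotient.inductionOn₂ a b fun V W h => ?_
      exact Quotient.sound (QuotientGroup.leftRel_apply.mpr ((hrel V W).mp h))
    · rintro ⟨ρ, hρ⟩
      obtain ⟨V, hV, h⟩ := exists_unitary_of_mem_isospectralSet hU hw hwi hρ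
      exact ⟨Quotient.mk _ ⟨V, hV⟩, Subtype.ext h.symm⟩
  have : Continuous (Equiv.ofBijective g hgb) := hg
  exact ⟨this.homeoOfEquivCompactToT2⟩

end

/-! ### Slice charts and embedded submanifolds -/

section Slice

variable {E F W : Type*} [NormedAddCommGroup E] [NormedSpace ℝ E] [NormedAddCommGroup F]
  [NormedSpace ℝ F] [NormedAddCommGroup W] [NormedSpace ℝ W] {S : Set W}

/-- An open partial homeomorphism of the ambient space that flattens `S` to `E × {0}`. -/
structure IsSliceChart (S : Set W) (Θ : OpenPartialHomeomorph W (E × F)) : Prop where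
  contDiffOn : ContDiffOn ℝ ∞ Θ Θ.source
  contDiffOn_symm : ContDiffOn ℝ ∞ Θ.symm Θ.target
  mem_iff : ∀ y ∈ Θ.source, y ∈ S ↔ (Θ y).2 = 0

open Classical in
/-- The chart of `S` induced by a slice chart. -/
noncomputable def IsSliceChart.chart {Θ : OpenPartialHomeomorph W (E × F)} (h : IsSliceChart S Θ) (x : S) :
    OpenPartialHomeomorph S E :=
  { toFun := fun s => (Θ s).1
    invFun := fun e => if h' : Θ.symm (e, 0) ∈ S then ⟨Θ.symm (e, 0), h'⟩ else x
    source := Subtype.val ⁻¹' Θ.source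
    target := (fun e => (e, (0 : F))) ⁻¹' Θ.target
    map_source' := by
      intro s hs
      have h1 : ((Θ s).1, (0 : F)) = Θ s := Prod.ext rfl ((h.mem_iff s hs).mp s.2).symm
      change ((Θ s).1, (0 : F)) ∈ Θ.target
      rw [h1]
      exact Θ.map_source hs
    map_target' := by
      intro e he
      have h1 : Θ.symm (e, 0) ∈ S := (h.mem_iff _ (Θ.map_target he)).mpr (by rw [Θ.right_inv he])
      rw [dif_pos h1]
      exact Θ.map_target he
    left_inv' := by
      intro s hs
      have h1 : ((Θ s).1, (0 : F)) = Θ s := Prod.ext rfl ((h.mem_iff s hs).mp s.2).symm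
      have h2 : Θ.symm ((Θ s).1, 0) = s := by rw [h1, Θ.left_inv hs]
      rw [dif_pos (by rw [h2]; exact s.2)]
      exact Subtype.ext h2
    right_inv' := by
      intro e he
      have h1 : Θ.symm (e, 0) ∈ S := (h.mem_iff _ (Θ.map_target he)).mpr (by rw [Θ.right_inv he])
      rw [dif_pos h1]
      change (Θ (Θ.symm (e, 0))).1 = e
      rw [Θ.right_inv he]
    open_source := Θ.open_source.preimage continuous_subtype_val
    open_target := Θ.open_target.preimage (by fun_prop)
    continuousOn_toFun := continuous_fst.comp_continuousOn
      (Θ.continuousOn.comp continuous_subtype_val.continuousOn fun _ hs => hs)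
    continuousOn_invFun := by
      rw [Topology.IsInducing.subtypeVal.continuousOn_iff]
      refine (Θ.continuousOn_symm.comp (f := fun e => (e, (0 : F))) (by fun_prop)
        fun _ he => he).congr ?_
      intro e he
      have h1 : Θ.symm (e, 0) ∈ S := (h.mem_iff _ (Θ.map_target he)).mpr (by rw [Θ.right_inv he])
      simp only [Function.comp_apply]
      rw [dif_pos h1] }

namespace IsSliceChart

variable {Θ Θ' : OpenPartialHomeomorph W (E × F)}

theorem chart_apply (h : IsSliceChart S Θ) (x s : S) : h.chart x s = (Θ s).1 := rfl

theorem mem_chart_source (h : IsSliceChart S Θ) (x s : S) :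
    s ∈ (h.chart x).source ↔ (s : W) ∈ Θ.source := Iff.rfl

theorem coe_chart_symm (h : IsSliceChart S Θ) (x : S) {e : E} (he : e ∈ (h.chart x).target) :
    ((h.chart x).symm e : W) = Θ.symm (e, 0) := by
  have h1 : Θ.symm (e, 0) ∈ S := (h.mem_iff _ (Θ.map_target he)).mpr (by rw [Θ.right_inv he])
  classical
  change ((if h' : Θ.symm (e, 0) ∈ S then (⟨Θ.symm (e, 0), h'⟩ : S) else x : S) : W) = _
  rw [dif_pos h1]

/-- The transition map is a component of the smooth ambient map `Θ' ∘ Θ.symm`, restricted to `E ×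
{0}`. -/
theorem contDiffOn_chart_symm_trans (h : IsSliceChart S Θ) (h' : IsSliceChart S Θ') (x x' : S) :
    ContDiffOn ℝ ∞ (h'.chart x' ∘ (h.chart x).symm) ((h.chart x).symm ≫ₕ h'.chart x').source := by
  have h1 : ContDiffOn ℝ ∞ (fun e : E => (Θ' (Θ.symm (e, (0 : F)))).1)
      ((h.chart x).symm ≫ₕ h'.chart x').source := by
    refine contDiff_fst.comp_contDiffOn ((h'.contDiffOn.comp
      (h.contDiffOn_symm.comp (f := fun e : E => (e, (0 : F))) (by fun_prop) ?_) ?_))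
    · intro e he
      exact he.1
    · intro e he
      have := he.2
      rw [Set.mem_preimage, mem_chart_source] at this
      change Θ.symm (e, 0) ∈ Θ'.source
      rw [← h.coe_chart_symm x he.1]
      exact this
  refine h1.congr fun e he => ?_
  rw [Function.comp_apply, chart_apply, h.coe_chart_symm x he.1]

end IsSliceChart

theorem OpenPartialHomeomorph.mem_maximalAtlas_of_contDiffOn (e : OpenPartialHomeomorph W W)
    (h1 : ContDiffOn ℝ ∞ e e.source) (h2 : ContDiffOn ℝ ∞ e.symm e.target) :
    e ∈ IsManifold.maximalAtlas 𝓘(ℝ, W) ∞ W := by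
  apply StructureGroupoid.mem_maximalAtlas_of_mem_groupoid
  rw [contDiffGroupoid, mem_groupoid_of_pregroupoid]
  simp only [contDiffPregroupoid]
  simpa using ⟨h1, h2⟩

/-- Between the induced chart and the slice chart the inclusion reads `e ↦ (e, 0)`, the normal form
of an immersion. The equivalence `L` carries the values of the slice chart back to `W`, where charts
of `W` take theirs. -/
theorem exists_chartedSpace_of_isSliceChart (L : (E × F) ≃L[ℝ] W)
    (hS : ∀ x : S, ∃ Θ : OpenPartialHomeomorph W (E × F), IsSliceChart S Θ ∧ (x : W) ∈ Θ.source) :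
    ∃ _ : ChartedSpace E S, IsManifold 𝓘(ℝ, E) ∞ S ∧
      IsSmoothEmbedding 𝓘(ℝ, E) 𝓘(ℝ, W) ∞ (Subtype.val : S → W) := by
  choose Θ hΘ hx using hS
  let c : ChartedSpace E S :=
    { atlas := Set.range fun x => (hΘ x).chart x
      chartAt := fun x => (hΘ x).chart x
      mem_chart_source := hx
      chart_mem_atlas := fun x => ⟨x, rfl⟩ }
  have hm : IsManifold 𝓘(ℝ, E) ∞ S := by
    refine isManifold_of_contDiffOn _ _ _ ?_
    rintro _ _ ⟨x, rfl⟩ ⟨y, rfl⟩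
    simpa using (hΘ x).contDiffOn_chart_symm_trans (hΘ y) x y
  refine ⟨c, hm, ⟨?_, Topology.IsEmbedding.subtypeVal⟩⟩
  have : IsImmersionOfComplement F 𝓘(ℝ, E) 𝓘(ℝ, W) ∞ (Subtype.val : S → W) := by
    intro x
    refine IsImmersionAtOfComplement.mk_of_charts L (chartAt E x)
      ((Θ x).trans L.toHomeomorph.toOpenPartialHomeomorph) (mem_chart_source E x) ?_
      (IsManifold.chart_mem_maximalAtlas x) ?_ ?_ ?_
    · simpa using hx x
    · apply OpenPartialHomeomorph.mem_maximalAtlas_of_contDiffOn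
      · simpa using L.contDiff.comp_contDiffOn (hΘ x).contDiffOn
      · have := (hΘ x).contDiffOn_symm.comp (s := L.symm ⁻¹' (Θ x).target)
          L.symm.contDiff.contDiffOn fun _ h => h
        simpa using this
    · intro s hs
      have hs' : (s : W) ∈ (Θ x).source := hs
      simpa using hs'
    · intro e he
      have he' : e ∈ ((hΘ x).chart x).target := by
        rw [OpenPartialHomeomorph.extend_target] at he
        exact he.1
      have h1 := (hΘ x).coe_chart_symm x he'
      have h2 : (chartAt E x : OpenPartialHomeomorph S E) = (hΘ x).chart x := rfl
      simp [h2, h1, (Θ x).right_inv he']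
  exact this.isImmersion

end Slice

/-! ### Off-diagonal Hermitian matrices and the flattening map -/

/-- The Hermitian matrices with zero diagonal. -/
def offDiagHermitian (n : ℕ) : Submodule ℝ (Matrix (Fin n) (Fin n) ℂ) where
  carrier := {Z | Zᴴ = Z ∧ ∀ i, Z i i = 0}
  add_mem' := fun {a b} ha hb => ⟨by rw [conjTranspose_add, ha.1, hb.1], fun i => by
    rw [Matrix.add_apply, ha.2, hb.2, add_zero]⟩
  zero_mem' := ⟨conjTranspose_zero, fun _ => rfl⟩
  smul_mem' := fun c a ha => ⟨by rw [conjTranspose_smul, ha.1, star_trivial], fun i => by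
    rw [Matrix.smul_apply, ha.2, smul_zero]⟩

theorem offDiagHermitian_apply_symm {n : ℕ} {Z : Matrix (Fin n) (Fin n) ℂ}
    (hZ : Z ∈ offDiagHermitian n) (i j : Fin n) : star (Z j i) = Z i j := by
  rw [← conjTranspose_apply, hZ.1]

/-- The projection of a matrix onto the off-diagonal part of its Hermitian part. -/
noncomputable def offDiagHermitianProj (n : ℕ) :
    Matrix (Fin n) (Fin n) ℂ →ₗ[ℝ] offDiagHermitian n where
  toFun Z := ⟨Matrix.of fun i j => if i = j then 0 else (Z i j + star (Z j i)) / 2, by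
    constructor
    · ext i j
      simp only [conjTranspose_apply, of_apply]
      by_cases h : i = j
      · simp [h]
      · simp [h, Ne.symm h, add_comm]
    · intro i; simp⟩
  map_add' Z Z' := by
    ext i j
    by_cases h : i = j
    · simp [h]
    · simp [h]; ring
  map_smul' c Z := by
    ext i j
    by_cases h : i = j
    · simp [h]
    · simp [h]; ring

theorem offDiagHermitianProj_apply_coe {n : ℕ} (Z : offDiagHermitian n) :
    offDiagHermitianProj n Z = Z := by
  ext i j
  change (if i = j then 0 else ((Z : Matrix (Fin n) (Fin n) ℂ) i j + star (Z.1 j i)) / 2) = Z.1 i j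
  split_ifs with h
  · rw [h, Z.2.2]
  · rw [offDiagHermitian_apply_symm Z.2]; ring

/-- A matrix whose off-diagonal Hermitian part vanishes is diagonal as soon as it is Hermitian. -/
theorem isDiag_of_mem_ker_offDiagHermitianProj {n : ℕ} {Y : Matrix (Fin n) (Fin n) ℂ}
    (h : offDiagHermitianProj n Y = 0) (hY : Yᴴ = Y) : Y.IsDiag := by
  intro i j hij
  have h1 : (if i = j then 0 else (Y i j + star (Y j i)) / 2) = 0 :=
    congrFun (congrFun (congrArg Subtype.val h) i) j
  rw [if_neg hij, ← conjTranspose_apply, hY] at h1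
  linear_combination h1

/-- Real coordinates on the Hermitian matrices with zero diagonal. -/
noncomputable def offDiagHermitianEquiv (n : ℕ) :
    offDiagHermitian n ≃ₗ[ℝ] ({p : Fin n × Fin n // p.1 ≠ p.2} → ℝ) where
  toFun Z p := if p.1.1 < p.1.2 then (Z.1 p.1.1 p.1.2).re else (Z.1 p.1.2 p.1.1).im
  map_add' Z Z' := by
    ext p
    by_cases h : p.1.1 < p.1.2 <;> simp [h]
  map_smul' c Z := by
    ext p
    by_cases h : p.1.1 < p.1.2 <;> simp [h]
  invFun f := ⟨Matrix.of fun i j => if h : i = j then 0 else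
      if i < j then ⟨f ⟨(i, j), h⟩, f ⟨(j, i), Ne.symm h⟩⟩
      else ⟨f ⟨(j, i), Ne.symm h⟩, - f ⟨(i, j), h⟩⟩, by
    constructor
    · ext i j
      rcases lt_trichotomy i j with h | h | h
      · simp [h, h.ne, h.ne', h.not_gt, Complex.ext_iff]
      · simp [h]
      · simp [h, h.ne, h.ne', h.not_gt, Complex.ext_iff]
    · intro i; simp⟩
  left_inv Z := by
    ext i j
    have h1 := offDiagHermitian_apply_symm Z.2 i j
    rcases lt_trichotomy i j with h | h | h
    · simp [h, h.ne, h.not_gt]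
    · subst h; simp [Z.2.2]
    · simp [h, h.ne', h.not_gt, ← h1, Complex.ext_iff]
  right_inv f := by
    ext ⟨⟨i, j⟩, hp⟩
    rcases lt_trichotomy i j with h | h | h
    · simp [h, h.ne]
    · exact absurd h hp
    · simp [h, h.ne, h.not_gt]

theorem finrank_offDiagHermitian (n : ℕ) :
    Module.finrank ℝ (offDiagHermitian n) = n ^ 2 - n := by
  rw [(offDiagHermitianEquiv n).finrank_eq, Module.finrank_fintype_fun_eq_card,
    Fintype.card_subtype]
  have : (Finset.univ.filter fun p : Fin n × Fin n => p.1 ≠ p.2) =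
      (Finset.univ : Finset (Fin n)).offDiag := by
    ext p; simp
  rw [this, Finset.offDiag_card, Finset.card_univ, Fintype.card_fin, sq]

/-- Division of the entries of a matrix by the differences of the numbers `w`. -/
noncomputable def divDiff {n : ℕ} (w : Fin n → ℝ) :
    Matrix (Fin n) (Fin n) ℂ →ₗ[ℝ] Matrix (Fin n) (Fin n) ℂ where
  toFun Z := Matrix.of fun i j => Z i j / ((w j - w i : ℝ) : ℂ)
  map_add' Z Z' := by ext i j; simp [add_div]
  map_smul' c Z := by ext i j; simp [mul_div_assoc]

theorem divDiff_apply {n : ℕ} (w : Fin n → ℝ) (Z : Matrix (Fin n) (Fin n) ℂ) (i j : Fin n) :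
    divDiff w Z i j = Z i j / ((w j - w i : ℝ) : ℂ) := rfl

/-- The denominators are real and antisymmetric in the two indices. Skewness makes the exponential
of `divDiff w Z` unitary. -/
theorem conjTranspose_divDiff {n : ℕ} (w : Fin n → ℝ) {Z : Matrix (Fin n) (Fin n) ℂ}
    (hZ : Z ∈ offDiagHermitian n) : (divDiff w Z)ᴴ = -divDiff w Z := by
  ext i j
  rw [conjTranspose_apply, Matrix.neg_apply, divDiff_apply, divDiff_apply, star_div₀,
    offDiagHermitian_apply_symm hZ, ← div_neg]
  congr 1
  simp

/-- Commuting `X` with the diagonal matrix multiplies the entry `X i j` by `w j - w i`, which undoes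
the division. The diagonal entries, where the division is by zero, vanish on both sides. -/
theorem divDiff_commutator {n : ℕ} {w : Fin n → ℝ} (hw : Function.Injective w)
    {Z : Matrix (Fin n) (Fin n) ℂ} (hZ : Z ∈ offDiagHermitian n) :
    divDiff w Z * diagonal (fun k => (w k : ℂ)) - diagonal (fun k => (w k : ℂ)) * divDiff w Z =
      Z := by
  ext i j
  rw [Matrix.sub_apply, mul_diagonal, diagonal_mul, divDiff_apply]
  by_cases h : i = j
  · subst h; rw [hZ.2]; simp
  · have : ((w j - w i : ℝ) : ℂ) ≠ 0 := by
      rw [Complex.ofReal_ne_zero, sub_ne_zero]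
      exact fun h' => h (hw h').symm
    field_simp
    push_cast
    ring

theorem exp_mem_unitaryGroup {n : ℕ} {X : Matrix (Fin n) (Fin n) ℂ} (hX : Xᴴ = -X) :
    NormedSpace.exp X ∈ unitaryGroup (Fin n) ℂ := by
  let _ : NormedAlgebra ℚ (Matrix (Fin n) (Fin n) ℂ) := NormedAlgebra.restrictScalars ℚ ℂ _
  exact NormedSpace.exp_mem_unitary_of_mem_skewAdjoint (skewAdjoint.mem_iff.mpr hX)

theorem conjTranspose_exp_of_skew {n : ℕ} {X : Matrix (Fin n) (Fin n) ℂ} (hX : Xᴴ = -X) :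
    (NormedSpace.exp X)ᴴ = NormedSpace.exp (-X) := by
  rw [← hX, Matrix.exp_conjTranspose]

theorem contDiff_exp_matrix (n : ℕ) :
    ContDiff ℝ ω (NormedSpace.exp : Matrix (Fin n) (Fin n) ℂ → Matrix (Fin n) (Fin n) ℂ) := by
  rw [contDiff_iff_contDiffAt]
  intro x
  exact (NormedSpace.exp_analytic (𝕂 := ℝ) x).contDiffAt

/-- The map `Z ↦ exp X (D + Z - Z') exp (-X)`, where `Z'` is the projection of `Z` to the
Hermitian matrices with zero diagonal and `[X, D] = Z'`. -/
noncomputable def flattening {n : ℕ} (w : Fin n → ℝ) (Z : Matrix (Fin n) (Fin n) ℂ) :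
    Matrix (Fin n) (Fin n) ℂ :=
  NormedSpace.exp (divDiff w (offDiagHermitianProj n Z)) *
    (diagonal (fun k => (w k : ℂ)) + (Z - offDiagHermitianProj n Z)) *
    NormedSpace.exp (-divDiff w (offDiagHermitianProj n Z))

theorem contDiff_flattening {n : ℕ} (w : Fin n → ℝ) : ContDiff ℝ ω (flattening w) := by
  have h1 : ContDiff ℝ ω fun Z : Matrix (Fin n) (Fin n) ℂ =>
      (offDiagHermitianProj n Z : Matrix (Fin n) (Fin n) ℂ) :=
    ((offDiagHermitian n).subtype ∘ₗ offDiagHermitianProj n).toContinuousLinearMap.contDiff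
  have h2 : ContDiff ℝ ω fun Z : Matrix (Fin n) (Fin n) ℂ =>
      divDiff w (offDiagHermitianProj n Z) :=
    (divDiff w).toContinuousLinearMap.contDiff.comp h1
  exact (((contDiff_exp_matrix n).comp h2).mul (contDiff_const.add (contDiff_id.sub h1))).mul
    ((contDiff_exp_matrix n).comp h2.neg)

/-- To first order `exp X (D + Y) exp (-X)` is `D + [X, D] + Y`. Here `[X, D]` is the projection of
`Z` and `Y` is the remainder, so the linear part is `Z` itself. -/
theorem hasFDerivAt_flattening {n : ℕ} {w : Fin n → ℝ} (hw : Function.Injective w) :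
    HasFDerivAt (flattening w) (ContinuousLinearMap.id ℝ (Matrix (Fin n) (Fin n) ℂ)) 0 := by
  let p := ((offDiagHermitian n).subtype ∘ₗ offDiagHermitianProj n).toContinuousLinearMap
  let q := (divDiff w).toContinuousLinearMap ∘L p
  have h0 : q 0 = 0 := map_zero q
  have h1 : HasFDerivAt p p 0 := p.hasFDerivAt
  have h2 : HasFDerivAt q q 0 := q.hasFDerivAt
  have he : HasFDerivAt (NormedSpace.exp : Matrix (Fin n) (Fin n) ℂ → _)
      (1 : Matrix (Fin n) (Fin n) ℂ →L[ℝ] Matrix (Fin n) (Fin n) ℂ) (q 0) := by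
    rw [h0]; exact (hasStrictFDerivAt_exp_zero (𝕂 := ℝ)).hasFDerivAt
  have he' : HasFDerivAt (NormedSpace.exp : Matrix (Fin n) (Fin n) ℂ → _)
      (1 : Matrix (Fin n) (Fin n) ℂ →L[ℝ] Matrix (Fin n) (Fin n) ℂ) (-q 0) := by
    rw [h0, neg_zero]; exact (hasStrictFDerivAt_exp_zero (𝕂 := ℝ)).hasFDerivAt
  have h3 := (he.comp (0 : Matrix (Fin n) (Fin n) ℂ) h2).mul'
    (((hasFDerivAt_id (𝕜 := ℝ) (0 : Matrix (Fin n) (Fin n) ℂ)).sub h1).const_add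
      (diagonal (fun k => (w k : ℂ))))
  have h4 := h3.mul' (he'.comp (0 : Matrix (Fin n) (Fin n) ℂ) h2.neg)
  refine HasFDerivAt.congr_fderiv h4 ?_
  ext1 Z
  have h5 := divDiff_commutator hw (offDiagHermitianProj n Z).2
  have h6 : q Z * diagonal (fun k => (w k : ℂ)) - diagonal (fun k => (w k : ℂ)) * q Z = p Z := h5
  simp [h0]
  rw [← h6]
  abel

/-! ### Slice charts of the isospectral set -/

section

variable {E F W : Type*} [NormedAddCommGroup E] [NormedSpace ℝ E] [NormedAddCommGroup F]
  [NormedSpace ℝ F] [NormedAddCommGroup W] [NormedSpace ℝ W] {S : Set W}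

/-- A local parametrization of the ambient space in which `S` is flat yields a slice chart. -/
theorem exists_isSliceChart [CompleteSpace E] [CompleteSpace F] {G : E × F → W}
    {G' : (E × F) ≃L[ℝ] W} (hG : ContDiff ℝ ω G) (hG' : HasFDerivAt G (G' : E × F →L[ℝ] W) 0)
    (hS : ∀ᶠ p in nhds (0 : E × F), G p ∈ S ↔ p.2 = 0) :
    ∃ Θ : OpenPartialHomeomorph W (E × F), IsSliceChart S Θ ∧ G 0 ∈ Θ.source := by
  have hω : (ω : WithTop ℕ∞) ≠ 0 := by simp
  let Φ := hG.contDiffAt.toOpenPartialHomeomorph G hG' hω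
  have hΦ : (0 : E × F) ∈ Φ.source := hG.contDiffAt.mem_toOpenPartialHomeomorph_source hG' hω
  have hΦG : ∀ p, Φ p = G p := fun p => rfl
  obtain ⟨O, hO, hOo, h0⟩ := eventually_nhds_iff.mp hS
  have h1 : ContDiffAt ℝ ω Φ.symm (G 0) := hG.contDiffAt.to_localInverse hG' hω
  -- Analyticity at a point spreads to a neighbourhood. For `C^∞` at a point the neighbourhoods
  -- could shrink with the order, which is why `G` is taken analytic.
  obtain ⟨O', hO', hOo', h0'⟩ := eventually_nhds_iff.mp (h1.eventually (by simp))
  let Θ := (Φ.restrOpen O hOo).symm.restrOpen O' hOo'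
  have hs : ∀ y ∈ Θ.source, y ∈ Φ.target ∧ Φ.symm y ∈ O ∧ y ∈ O' := by
    intro y hy
    simpa [Θ, and_assoc] using hy
  refine ⟨Θ, ⟨?_, ?_, ?_⟩, ?_⟩
  · intro y hy
    exact ((hO' y (hs y hy).2.2).of_le le_top).contDiffWithinAt
  · exact (hG.of_le le_top).contDiffOn
  · intro y hy
    have h2 := hO _ (hs y hy).2.1
    rw [← hΦG, Φ.right_inv (hs y hy).1] at h2
    exact h2
  · have h2 : Φ.symm (G 0) = 0 := Φ.left_inv hΦ
    have h3 : G 0 ∈ Φ.target := Φ.map_source hΦ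
    simp [Θ, h2, h0, h0', h3]

end

/-- Conjugation by a unitary matrix as a real linear equivalence. -/
noncomputable def unitaryConjEquiv {n : ℕ} {V : Matrix (Fin n) (Fin n) ℂ}
    (hV : V ∈ unitaryGroup (Fin n) ℂ) :
    Matrix (Fin n) (Fin n) ℂ ≃L[ℝ] Matrix (Fin n) (Fin n) ℂ :=
  LinearEquiv.toContinuousLinearEquiv
    { toFun := fun Z => V * Z * Vᴴ
      map_add' := fun Z Z' => by rw [Matrix.mul_add, Matrix.add_mul]
      map_smul' := fun c Z => by simp
      invFun := fun Z => Vᴴ * Z * V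
      left_inv := fun Z => by
        have h : Vᴴ * V = 1 := Matrix.mem_unitaryGroup_iff'.mp hV
        calc Vᴴ * (V * Z * Vᴴ) * V = (Vᴴ * V) * Z * (Vᴴ * V) := by simp only [Matrix.mul_assoc]
          _ = Z := by rw [h, Matrix.one_mul, Matrix.mul_one]
      right_inv := fun Z => by
        have h : V * Vᴴ = 1 := Matrix.mem_unitaryGroup_iff.mp hV
        calc V * (Vᴴ * Z * V) * Vᴴ = (V * Vᴴ) * Z * (V * Vᴴ) := by simp only [Matrix.mul_assoc]
          _ = Z := by rw [h, Matrix.one_mul, Matrix.mul_one] }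

theorem unitaryConjEquiv_apply {n : ℕ} {V : Matrix (Fin n) (Fin n) ℂ}
    (hV : V ∈ unitaryGroup (Fin n) ℂ) (Z : Matrix (Fin n) (Fin n) ℂ) :
    unitaryConjEquiv hV Z = V * Z * Vᴴ := rfl

/-- Every matrix is the sum of a Hermitian matrix with zero diagonal and of a matrix that projects
to zero. -/
noncomputable def offDiagSplitting (n : ℕ) :
    (EuclideanSpace ℝ (Fin (n ^ 2 - n)) × LinearMap.ker (offDiagHermitianProj n)) ≃L[ℝ]
      Matrix (Fin n) (Fin n) ℂ :=
  LinearEquiv.toContinuousLinearEquiv <|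
    (LinearEquiv.prodCongr
      (LinearEquiv.ofFinrankEq (EuclideanSpace ℝ (Fin (n ^ 2 - n))) (offDiagHermitian n)
        (by rw [finrank_euclideanSpace_fin, finrank_offDiagHermitian]))
      (LinearEquiv.refl ℝ (LinearMap.ker (offDiagHermitianProj n)))).trans
    (Submodule.prodEquivOfIsCompl _ _
      (LinearMap.isCompl_of_proj fun Z => offDiagHermitianProj_apply_coe Z))

theorem sub_proj_offDiagSplitting {n : ℕ}
    (p : EuclideanSpace ℝ (Fin (n ^ 2 - n)) × LinearMap.ker (offDiagHermitianProj n)) :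
    offDiagSplitting n p - offDiagHermitianProj n (offDiagSplitting n p) = p.2 := by
  let e := LinearEquiv.ofFinrankEq (EuclideanSpace ℝ (Fin (n ^ 2 - n))) (offDiagHermitian n)
        (by rw [finrank_euclideanSpace_fin, finrank_offDiagHermitian])
  have h1 : offDiagSplitting n p = (e p.1 : Matrix (Fin n) (Fin n) ℂ) + p.2 := rfl
  have h2 : offDiagHermitianProj n p.2 = 0 := p.2.2
  rw [h1, map_add, offDiagHermitianProj_apply_coe, h2, add_zero, add_sub_cancel_left]

section

variable {n : ℕ} {ρd U : Matrix (Fin n) (Fin n) ℂ} {w : Fin n → ℝ}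

theorem unitary_conj_flattening {V : Matrix (Fin n) (Fin n) ℂ} (w : Fin n → ℝ)
    (Z : Matrix (Fin n) (Fin n) ℂ) :
    V * flattening w Z * Vᴴ =
      (V * NormedSpace.exp (divDiff w (offDiagHermitianProj n Z))) *
      (diagonal (fun k => (w k : ℂ)) + (Z - offDiagHermitianProj n Z)) *
      (V * NormedSpace.exp (divDiff w (offDiagHermitianProj n Z)))ᴴ := by
  rw [flattening, conjTranspose_mul,
    conjTranspose_exp_of_skew (conjTranspose_divDiff w (offDiagHermitianProj n Z).2)]
  simp only [Matrix.mul_assoc]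

/-- Membership makes `D + Y` Hermitian with the spectrum of `D`, where `Y` is the transversal part
of `Z`. Then `Y` is Hermitian and projects to zero, hence is diagonal, and it permutes the entries
of `w`. The bound on the diagonal of `Z` excludes every permutation but the identity. -/
theorem unitary_conj_flattening_mem_iff (hd : IsDensityMatrix ρd)
    (hU : U ∈ unitaryGroup (Fin n) ℂ) (hw : ρd = U * diagonal (fun k => (w k : ℂ)) * Uᴴ)
    (hwi : Function.Injective w) {V : Matrix (Fin n) (Fin n) ℂ}
    (hV : V ∈ unitaryGroup (Fin n) ℂ) {Z : Matrix (Fin n) (Fin n) ℂ}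
    (hZ : ∀ i j, i ≠ j → ‖Z i i‖ < |w j - w i|) :
    V * flattening w Z * Vᴴ ∈ isospectralSet ρd ↔ Z - offDiagHermitianProj n Z = 0 := by
  have hX := conjTranspose_divDiff w (offDiagHermitianProj n Z).2
  rw [unitary_conj_flattening]
  set X := divDiff w (offDiagHermitianProj n Z)
  have hT : V * NormedSpace.exp X ∈ unitaryGroup (Fin n) ℂ := mul_mem hV (exp_mem_unitaryGroup hX)
  set T := V * NormedSpace.exp X
  set Y : Matrix (Fin n) (Fin n) ℂ := Z - offDiagHermitianProj n Z with hY
  constructor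
  · intro h
    have h1 : (diagonal (fun k => (w k : ℂ)) + Y)ᴴ = diagonal (fun k => (w k : ℂ)) + Y := by
      have h2 := (unitary_conj_mem_isospectralSet (conjTranspose_mem_unitaryGroup hT)
        h).1.posSemidef.isHermitian
      have h3 := unitaryConjEquiv hT |>.symm_apply_apply (diagonal (fun k => (w k : ℂ)) + Y)
      change Tᴴ * (T * (diagonal (fun k => (w k : ℂ)) + Y) * Tᴴ) * T = _ at h3
      rw [conjTranspose_conjTranspose, h3] at h2
      exact h2
    have hYH : Yᴴ = Y := by
      rw [conjTranspose_add, diagonal_conjTranspose] at h1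
      have h2 : star (fun k => (w k : ℂ)) = fun k => (w k : ℂ) := by ext k; simp
      rw [h2] at h1
      exact add_left_cancel h1
    have hker : offDiagHermitianProj n Y = 0 := by
      rw [hY, map_sub, offDiagHermitianProj_apply_coe, sub_self]
    have hdiag := isDiag_of_mem_ker_offDiagHermitianProj hker hYH
    have hre : ∀ i, Y i i = ((Y i i).re : ℂ) := by
      intro i
      have : star (Y i i) = Y i i := by rw [← conjTranspose_apply, hYH]
      exact (Complex.conj_eq_iff_re.mp this).symm
    have h4 : diagonal (fun k => (w k : ℂ)) + Y =
        diagonal (fun k => ((w k + (Y k k).re : ℝ) : ℂ)) := by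
      ext i j
      by_cases hij : i = j
      · subst hij
        rw [Matrix.add_apply, diagonal_apply_eq, diagonal_apply_eq, Complex.ofReal_add, ← hre i]
      · rw [Matrix.add_apply, diagonal_apply_ne _ hij, diagonal_apply_ne _ hij, hdiag hij, add_zero]
    rw [h4] at h
    obtain ⟨τ, hτ⟩ := exists_perm_of_conj_diagonal_mem hU hw hwi hT h
    have hZY : ∀ i, Z i i = Y i i := by
      intro i
      rw [hY, Matrix.sub_apply, (offDiagHermitianProj n Z).2.2, sub_zero]
    have h5 : ∀ i, (Y i i).re = w (τ i) - w i := by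
      intro i
      have := congrFun hτ i
      simp only [Function.comp_apply] at this
      linarith
    ext i j
    by_cases hij : i = j
    · subst hij
      rw [hre, h5]
      by_cases h6 : τ i = i
      · rw [h6]; simp
      -- A moved index would give `‖Z i i‖ = |w (τ i) - w i|`, against the strict bound `hZ`.
      · exfalso
        have h7 := hZ i (τ i) (Ne.symm h6)
        rw [hZY, hre, h5, Complex.norm_real, Real.norm_eq_abs] at h7
        exact lt_irrefl _ h7
    · exact hdiag hij
  · intro h
    rw [h, add_zero]
    exact conj_diagonal_mem_isospectralSet hd hU hw 1 hT

/-- The point is `V D V†`, the value at zero of the flattening map conjugated by `V`. The bound on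
diagonal entries holds near zero because the entries of `w` are distinct. -/
theorem exists_isSliceChart_isospectralSet (hd : IsDensityMatrix ρd)
    (hU : U ∈ unitaryGroup (Fin n) ℂ) (hw : ρd = U * diagonal (fun k => (w k : ℂ)) * Uᴴ)
    (hwi : Function.Injective w) (x : isospectralSet ρd) :
    ∃ Θ : OpenPartialHomeomorph (Matrix (Fin n) (Fin n) ℂ)
      (EuclideanSpace ℝ (Fin (n ^ 2 - n)) × LinearMap.ker (offDiagHermitianProj n)),
      IsSliceChart (isospectralSet ρd) Θ ∧ (x : Matrix (Fin n) (Fin n) ℂ) ∈ Θ.source := by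
  obtain ⟨V, hV, hx⟩ := exists_unitary_of_mem_isospectralSet hU hw hwi x.2
  have h0 : unitaryConjEquiv hV (flattening w (offDiagSplitting n 0)) = x := by
    rw [hx, map_zero, unitaryConjEquiv_apply, flattening]
    simp
  rw [← h0]
  refine exists_isSliceChart
    (G := fun p => unitaryConjEquiv hV (flattening w (offDiagSplitting n p)))
    (G' := (offDiagSplitting n).trans (unitaryConjEquiv hV)) ?_ ?_ ?_
  · exact (unitaryConjEquiv hV).contDiff.comp
      ((contDiff_flattening w).comp (offDiagSplitting n).contDiff)
  · have h1 : HasFDerivAt (flattening w)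
        (ContinuousLinearMap.id ℝ (Matrix (Fin n) (Fin n) ℂ)) (offDiagSplitting n 0) := by
      rw [map_zero]; exact hasFDerivAt_flattening hwi
    exact ((unitaryConjEquiv hV).hasFDerivAt.comp _
      (h1.comp _ (offDiagSplitting n).hasFDerivAt)).congr_fderiv (ContinuousLinearMap.ext fun p => rfl)
  · have h1 : ∀ᶠ p in nhds (0 : EuclideanSpace ℝ (Fin (n ^ 2 - n)) ×
        LinearMap.ker (offDiagHermitianProj n)),
        ∀ i j, i ≠ j → ‖offDiagSplitting n p i i‖ < |w j - w i| := by
      simp only [Filter.eventually_all]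
      intro i j hij
      have hc : Continuous fun p => ‖offDiagSplitting n p i i‖ :=
        ((offDiagSplitting n).continuous.matrix_elem i i).norm
      refine hc.continuousAt.eventually_lt_const ?_
      have h2 : ‖offDiagSplitting n 0 i i‖ = 0 := by
        rw [map_zero, Matrix.zero_apply, norm_zero]
      refine h2.trans_lt ?_
      rw [abs_pos, sub_ne_zero]
      exact fun h => hij (hwi h).symm
    filter_upwards [h1] with p hp
    rw [unitaryConjEquiv_apply, unitary_conj_flattening_mem_iff hd hU hw hwi hV hp,
      sub_proj_offDiagSplitting]
    exact Submodule.coe_eq_zero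

end

/-! ### Critical points and Hessians in a local parametrization -/

theorem two_le_infty : (2 : WithTop ℕ∞) ≤ ∞ :=
  WithTop.coe_le_coe.mpr (le_top : (2 : ℕ∞) ≤ ⊤)

section

variable {d : ℕ} {M : Type*} [TopologicalSpace M]
  [ChartedSpace (EuclideanSpace ℝ (Fin d)) M]
  {W : Type*} [NormedAddCommGroup W] [NormedSpace ℝ W]

theorem ContMDiff.contDiffAt_comp_extChartAt_symm [IsManifold (𝓡 d) ∞ M] {f : M → W}
    (hf : ContMDiff (𝓡 d) 𝓘(ℝ, W) ∞ f) (x : M) :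
    ContDiffAt ℝ ∞ (f ∘ (extChartAt (𝓡 d) x).symm) (extChartAt (𝓡 d) x x) := by
  rw [← contMDiffAt_iff_contDiffAt]
  refine ContMDiffAt.comp (I' := 𝓡 d) _ (hf _) ?_
  exact (contMDiffOn_extChartAt_symm x).contMDiffAt (extChartAt_target_mem_nhds x)

theorem isCriticalPt_iff_fderiv [IsManifold (𝓡 d) ∞ M] {f : M → ℝ} (hf : ContMDiff (𝓡 d) 𝓘(ℝ, ℝ) ∞ f) (x : M) :
    IsCriticalPt d f x ↔
      fderiv ℝ (f ∘ (extChartAt (𝓡 d) x).symm) (extChartAt (𝓡 d) x x) = 0 := by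
  have h1 : MDifferentiableAt (𝓡 d) 𝓘(ℝ, ℝ) f x := (hf x).mdifferentiableAt (by simp)
  have h2 : mfderiv (𝓡 d) 𝓘(ℝ, ℝ) f x =
      fderiv ℝ (f ∘ (extChartAt (𝓡 d) x).symm) (extChartAt (𝓡 d) x x) := by
    refine (if_pos h1).trans ?_
    change fderivWithin ℝ (f ∘ (extChartAt (𝓡 d) x).symm) (Set.range (𝓡 d)) _ = _
    rw [ModelWithCorners.range_eq_univ, fderivWithin_univ]
  rw [IsCriticalPt, and_iff_right h1, h2]
  exact Iff.rfl

theorem chartHessian_symm [IsManifold (𝓡 d) ∞ M] {f : M → ℝ} (hf : ContMDiff (𝓡 d) 𝓘(ℝ, ℝ) ∞ f) (x : M)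
    (v v' : EuclideanSpace ℝ (Fin d)) : chartHessian d f x v v' = chartHessian d f x v' v :=
  ((hf.contDiffAt_comp_extChartAt_symm x).isSymmSndFDerivAt
    (by rw [minSmoothness_of_isRCLikeNormedField]; exact two_le_infty)).eq v v'

/-- The second derivative of a composition along a curve through a critical point. -/
theorem hasDerivAt_critical_second {E : Type*} [NormedAddCommGroup E] [NormedSpace ℝ E]
    {F : E → ℝ} {γ : ℝ → E} {g g' : ℝ → ℝ} {c : ℝ} (hF : ContDiffAt ℝ ∞ F (γ 0))
    (hγ : ContDiffAt ℝ ∞ γ 0) (hF0 : fderiv ℝ F (γ 0) = 0)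
    (hg : g =ᶠ[nhds 0] F ∘ γ) (hg' : ∀ t, HasDerivAt g (g' t) t) (hc : HasDerivAt g' c 0) :
    fderiv ℝ (fderiv ℝ F) (γ 0) (deriv γ 0) (deriv γ 0) = c := by
  have h1 : ∀ᶠ t in nhds (0 : ℝ), DifferentiableAt ℝ γ t :=
    ((hγ.of_le (m := 1) (by simp)).eventually (by simp)).mono fun t ht =>
      ht.differentiableAt (by simp)
  have h2 : ∀ᶠ t in nhds (0 : ℝ), DifferentiableAt ℝ F (γ t) :=
    hγ.continuousAt.eventually (((hF.of_le (m := 1) (by simp)).eventually (by simp)).mono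
      fun y hy => hy.differentiableAt (by simp))
  -- Near zero `g'` is the derivative of `F ∘ γ`, by uniqueness of derivatives.
  have h3 : g' =ᶠ[nhds 0] fun t => fderiv ℝ F (γ t) (deriv γ t) := by
    filter_upwards [h1, h2, hg.eventually_nhds] with t ht1 ht2 ht3
    have h4 : HasDerivAt (F ∘ γ) (fderiv ℝ F (γ t) (deriv γ t)) t :=
      ht2.hasFDerivAt.comp_hasDerivAt t ht1.hasDerivAt
    exact (hg' t).unique (h4.congr_of_eventuallyEq ht3)
  have h5 : DifferentiableAt ℝ (fderiv ℝ F) (γ 0) :=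
    (hF.fderiv_right (m := 1) (by rw [one_add_one_eq_two]; exact two_le_infty)).differentiableAt (by simp)
  have h6 : DifferentiableAt ℝ (deriv γ) 0 := by
    have h7 : DifferentiableAt ℝ (fderiv ℝ γ) 0 :=
      (hγ.fderiv_right (m := 1) (by rw [one_add_one_eq_two]; exact two_le_infty)).differentiableAt (by simp)
    exact h7.clm_apply (differentiableAt_const (1 : ℝ))
  -- The product rule gives `D²F(γ', γ') + DF(γ'')`; the last term drops out because `DF` vanishes
  -- at `γ 0`.
  have h8 := (h5.hasFDerivAt.comp_hasDerivAt (0 : ℝ)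
    (hγ.differentiableAt (by simp)).hasDerivAt).clm_apply h6.hasDerivAt
  have h9 := h8.unique (hc.congr_of_eventuallyEq h3.symm)
  simpa [hF0] using h9

theorem eventually_extChartAt_symm_comp {K : Type*} [NormedAddCommGroup K] [NormedSpace ℝ K]
    {ψ : K → M} (hψ : ContMDiff 𝓘(ℝ, K) (𝓡 d) ∞ ψ) :
    ∀ᶠ Z in nhds (0 : K), (extChartAt (𝓡 d) (ψ 0)).symm (extChartAt (𝓡 d) (ψ 0) (ψ Z)) = ψ Z := by
  filter_upwards [hψ.continuous.continuousAt.eventually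
    (extChartAt_source_mem_nhds (I := 𝓡 d) (ψ 0))] with Z hZ
  exact (extChartAt (𝓡 d) (ψ 0)).left_inv hZ

theorem contDiffAt_extChartAt_comp [IsManifold (𝓡 d) ∞ M] {K : Type*} [NormedAddCommGroup K] [NormedSpace ℝ K]
    {ψ : K → M} (hψ : ContMDiff 𝓘(ℝ, K) (𝓡 d) ∞ ψ) :
    ContDiffAt ℝ ∞ (extChartAt (𝓡 d) (ψ 0) ∘ ψ) 0 := by
  rw [← contMDiffAt_iff_contDiffAt]
  exact ContMDiffAt.comp (I' := 𝓡 d) _ contMDiffAt_extChartAt (hψ 0)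

theorem fderiv_comp_parametrization [IsManifold (𝓡 d) ∞ M] {K : Type*} [NormedAddCommGroup K] [NormedSpace ℝ K]
    {k : M → W} (hk : ContMDiff (𝓡 d) 𝓘(ℝ, W) ∞ k)
    {ψ : K → M} (hψ : ContMDiff 𝓘(ℝ, K) (𝓡 d) ∞ ψ) :
    fderiv ℝ (k ∘ ψ) 0 =
      (fderiv ℝ (k ∘ (extChartAt (𝓡 d) (ψ 0)).symm) (extChartAt (𝓡 d) (ψ 0) (ψ 0))).comp
        (fderiv ℝ (extChartAt (𝓡 d) (ψ 0) ∘ ψ) 0) := by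
  have h1 : k ∘ ψ =ᶠ[nhds 0]
      (k ∘ (extChartAt (𝓡 d) (ψ 0)).symm) ∘ (extChartAt (𝓡 d) (ψ 0) ∘ ψ) := by
    filter_upwards [eventually_extChartAt_symm_comp hψ] with Z hZ
    simp only [Function.comp_apply, hZ]
  rw [h1.fderiv_eq]
  exact fderiv_comp (0 : K)
    ((hk.contDiffAt_comp_extChartAt_symm (ψ 0)).differentiableAt (by simp))
    ((contDiffAt_extChartAt_comp hψ).differentiableAt (by simp))

/-- Critical points and Hessians can be computed in any smooth local parametrization. -/
theorem exists_equiv_chartHessian [IsManifold (𝓡 d) ∞ M] {K : Type*} [NormedAddCommGroup K] [NormedSpace ℝ K]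
    [FiniteDimensional ℝ K] (hK : Module.finrank ℝ K = d)
    {f : M → ℝ} (hf : ContMDiff (𝓡 d) 𝓘(ℝ, ℝ) ∞ f)
    {ι : M → W} (hι : ContMDiff (𝓡 d) 𝓘(ℝ, W) ∞ ι)
    {ψ : K → M} (hψ : ContMDiff 𝓘(ℝ, K) (𝓡 d) ∞ ψ)
    (hinj : Function.Injective (fderiv ℝ (ι ∘ ψ) 0)) :
    (IsCriticalPt d f (ψ 0) ↔ fderiv ℝ (f ∘ ψ) 0 = 0) ∧
    (IsCriticalPt d f (ψ 0) → ∃ L : K ≃ₗ[ℝ] EuclideanSpace ℝ (Fin d),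
      ∀ (X : K) (g' : ℝ → ℝ) (c : ℝ), (∀ t, HasDerivAt (fun t : ℝ => f (ψ (t • X))) (g' t) t) →
        HasDerivAt g' c 0 → chartHessian d f (ψ 0) (L X) (L X) = c) := by
  have hh := contDiffAt_extChartAt_comp hψ
  have hfψ := fderiv_comp_parametrization hf hψ
  -- The derivative of `ι ∘ ψ` factors through that of `ψ` read in the chart, so the latter is
  -- injective too; equality of dimensions then makes it bijective.
  have hLinj : Function.Injective
      (fderiv ℝ (extChartAt (𝓡 d) (ψ 0) ∘ ψ) 0 : K →ₗ[ℝ] EuclideanSpace ℝ (Fin d)) := by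
    rw [fderiv_comp_parametrization hι hψ] at hinj
    exact Function.Injective.of_comp hinj
  let L : K ≃ₗ[ℝ] EuclideanSpace ℝ (Fin d) :=
    LinearEquiv.ofBijective _ ⟨hLinj, (LinearMap.injective_iff_surjective_of_finrank_eq_finrank
      (by rw [hK, finrank_euclideanSpace_fin])).mp hLinj⟩
  have hL : ∀ X, L X = fderiv ℝ (extChartAt (𝓡 d) (ψ 0) ∘ ψ) 0 X := fun X => rfl
  rw [isCriticalPt_iff_fderiv hf]
  refine ⟨?_, ?_⟩
  · rw [hfψ]
    constructor
    · intro h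
      rw [h, ContinuousLinearMap.zero_comp]
    · intro h
      ext1 v
      obtain ⟨X, rfl⟩ := L.surjective v
      rw [hL]
      exact DFunLike.congr_fun h X
  · intro hcrit
    refine ⟨L, fun X g' c hg' hc => ?_⟩
    have hl : ContDiff ℝ ∞ fun t : ℝ => t • X := contDiff_id.smul contDiff_const
    have h0 : (0 : ℝ) • X = 0 := zero_smul ℝ X
    have hγ : ContDiffAt ℝ ∞ (fun t : ℝ => extChartAt (𝓡 d) (ψ 0) (ψ (t • X))) 0 :=
      ContDiffAt.comp (g := extChartAt (𝓡 d) (ψ 0) ∘ ψ) (0 : ℝ) (by rw [h0]; exact hh)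
        hl.contDiffAt
    have hγ' : deriv (fun t : ℝ => extChartAt (𝓡 d) (ψ 0) (ψ (t • X))) 0 = L X := by
      have h1 : HasFDerivAt (extChartAt (𝓡 d) (ψ 0) ∘ ψ)
          (fderiv ℝ (extChartAt (𝓡 d) (ψ 0) ∘ ψ) 0) ((0 : ℝ) • X) := by
        rw [h0]; exact (hh.differentiableAt (by simp)).hasFDerivAt
      have h2 : HasDerivAt (fun t : ℝ => t • X) X 0 := by
        simpa using (hasDerivAt_id (0 : ℝ)).smul_const X
      exact (h1.comp_hasDerivAt (0 : ℝ) h2).deriv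
    have hev : (fun t : ℝ => f (ψ (t • X))) =ᶠ[nhds 0]
        (f ∘ (extChartAt (𝓡 d) (ψ 0)).symm) ∘
          (fun t : ℝ => extChartAt (𝓡 d) (ψ 0) (ψ (t • X))) := by
      have h1 : Filter.Tendsto (fun t : ℝ => t • X) (nhds 0) (nhds 0) := by
        simpa using hl.continuous.tendsto 0
      filter_upwards [h1.eventually (eventually_extChartAt_symm_comp hψ)] with t ht
      simp only [Function.comp_apply, ht]
    have h3 : extChartAt (𝓡 d) (ψ 0) (ψ ((0 : ℝ) • X)) = extChartAt (𝓡 d) (ψ 0) (ψ 0) := by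
      rw [h0]
    have h4 := hasDerivAt_critical_second
      (by rw [h3]; exact hf.contDiffAt_comp_extChartAt_symm (ψ 0)) hγ
      (by rw [h3]; exact hcrit) hev hg' hc
    rw [hγ', h3] at h4
    exact h4

end

/-! ### Derivatives of the overlap along unitary orbits -/

/-- The real linear functional `Z ↦ Re Tr (Z ρd)`. -/
noncomputable def reTraceMul {n : ℕ} (ρd : Matrix (Fin n) (Fin n) ℂ) :
    Matrix (Fin n) (Fin n) ℂ →L[ℝ] ℝ :=
  LinearMap.toContinuousLinearMap
    { toFun := fun Z => (Z * ρd).trace.re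
      map_add' := fun Z Z' => by rw [Matrix.add_mul, trace_add, Complex.add_re]
      map_smul' := fun c Z => by
        rw [Matrix.smul_mul, trace_smul, Complex.smul_re, RingHom.id_apply] }

theorem reTraceMul_apply {n : ℕ} (ρd Z : Matrix (Fin n) (Fin n) ℂ) :
    reTraceMul ρd Z = (Z * ρd).trace.re := rfl

theorem reTraceMul_unitary_conj {n : ℕ} (ρd V Z : Matrix (Fin n) (Fin n) ℂ) :
    reTraceMul ρd (V * Z * Vᴴ) = (Z * (Vᴴ * ρd * V)).trace.re := by
  rw [reTraceMul_apply, Matrix.mul_assoc, Matrix.mul_assoc, Matrix.trace_mul_comm]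
  simp only [Matrix.mul_assoc]

theorem overlap_eq_reTraceMul {n : ℕ} (ρd : Matrix (Fin n) (Fin n) ℂ) (ρ : isospectralSet ρd) :
    overlap ρd ρ = reTraceMul ρd ρ := rfl

theorem continuous_overlap {n : ℕ} (ρd : Matrix (Fin n) (Fin n) ℂ) : Continuous (overlap ρd) :=
  (reTraceMul ρd).continuous.comp continuous_subtype_val

/-- A Hermitian matrix that is orthogonal to the Hermitian matrices with zero diagonal is
diagonal. -/
theorem isDiag_iff_forall_re_trace_mul {n : ℕ} {B : Matrix (Fin n) (Fin n) ℂ} (hB : Bᴴ = B) :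
    B.IsDiag ↔ ∀ Z ∈ offDiagHermitian n, (Z * B).trace.re = 0 := by
  constructor
  · intro h Z hZ
    rw [← h.diagonal_diag, trace]
    simp [mul_diagonal, hZ.2]
  · intro h
    -- The test matrix is the off-diagonal part of `B` itself; its pairing with `B` is the sum of
    -- the squared off-diagonal moduli.
    let P : Matrix (Fin n) (Fin n) ℂ := offDiagHermitianProj n B
    have hP : ∀ i j, P i j = if i = j then 0 else B i j := by
      intro i j
      change (if i = j then 0 else (B i j + star (B j i)) / 2) = _
      rw [← conjTranspose_apply, hB, add_self_div_two]
    have h1 := h P (offDiagHermitianProj n B).2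
    have h2 : (P * B).trace.re = ∑ p : Fin n × Fin n, ‖P p.1 p.2‖ ^ 2 := by
      rw [trace, Fintype.sum_prod_type, Complex.re_sum]
      refine Finset.sum_congr rfl fun i _ => ?_
      rw [diag_apply, Matrix.mul_apply, Complex.re_sum]
      refine Finset.sum_congr rfl fun j _ => ?_
      rw [hP]
      split_ifs with hij
      · simp
      · rw [← congrFun (congrFun hB j) i, conjTranspose_apply, ← Complex.normSq_eq_norm_sq,
          Complex.star_def, Complex.mul_conj, Complex.ofReal_re]
    rw [h2, Finset.sum_eq_zero_iff_of_nonneg (fun _ _ => sq_nonneg _)] at h1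
    intro i j hij
    have h3 := h1 (i, j) (Finset.mem_univ _)
    simpa [hP, hij] using h3

/-- Differentiation replaces `A` by `[X, A]` and keeps the shape of the curve, so the formula can be
iterated. -/
theorem hasDerivAt_exp_conj {n : ℕ} (X A : Matrix (Fin n) (Fin n) ℂ) (t : ℝ) :
    HasDerivAt (fun t : ℝ => NormedSpace.exp (t • X) * A * NormedSpace.exp (-(t • X)))
      (NormedSpace.exp (t • X) * (X * A - A * X) * NormedSpace.exp (-(t • X))) t := by
  have h1 := hasDerivAt_exp_smul_const (𝕂 := ℝ) X t
  have h2 := hasDerivAt_exp_smul_const' (𝕂 := ℝ) (-X) t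
  have h3 := (h1.mul_const A).mul h2
  simp only [smul_neg] at h3
  refine h3.congr_deriv ?_
  simp only [Matrix.mul_sub, Matrix.sub_mul, Matrix.mul_assoc, Matrix.neg_mul, Matrix.mul_neg]
  abel

/-- The diagonal entries of the commutator are `2 ∑ j, |Z i j|² / (a j - a i)`. Weighting them by `b
i` and antisymmetrising in the two indices produces the differences of `b`. -/
theorem re_trace_commutator_divDiff {n : ℕ} (a b : Fin n → ℝ) {Z : Matrix (Fin n) (Fin n) ℂ}
    (hZ : Z ∈ offDiagHermitian n) :
    ((divDiff a Z * Z - Z * divDiff a Z) * diagonal (fun k => (b k : ℂ))).trace.re =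
      -∑ p : Fin n × Fin n, ‖Z p.1 p.2‖ ^ 2 * ((b p.2 - b p.1) / (a p.2 - a p.1)) := by
  have h1 : ∀ i j, Z i j * Z j i = ((‖Z i j‖ ^ 2 : ℝ) : ℂ) := by
    intro i j
    rw [← offDiagHermitian_apply_symm hZ j i, ← Complex.normSq_eq_norm_sq, Complex.star_def,
      Complex.mul_conj]
  have h2 : ∀ i j, ‖Z i j‖ = ‖Z j i‖ := by
    intro i j
    rw [← offDiagHermitian_apply_symm hZ i j, norm_star]
  have h3 : ((divDiff a Z * Z - Z * divDiff a Z) * diagonal (fun k => (b k : ℂ))).trace.re =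
      ∑ i, ∑ j, 2 * (‖Z i j‖ ^ 2 * (b i / (a j - a i))) := by
    rw [trace, Complex.re_sum]
    refine Finset.sum_congr rfl fun i _ => ?_
    rw [diag_apply, mul_diagonal, Matrix.sub_apply, Matrix.mul_apply, Matrix.mul_apply,
      ← Finset.sum_sub_distrib, Finset.sum_mul, Complex.re_sum]
    refine Finset.sum_congr rfl fun j _ => ?_
    have h4 : (divDiff a Z i j * Z j i - Z i j * divDiff a Z j i) * (b i : ℂ) =
        ((2 * (‖Z i j‖ ^ 2 * (b i / (a j - a i))) : ℝ) : ℂ) := by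
      rw [divDiff_apply, divDiff_apply, div_mul_eq_mul_div, mul_div_assoc', h1,
        ← neg_sub (a j) (a i)]
      push_cast
      rw [div_neg]
      ring
    rw [h4, Complex.ofReal_re]
  have h5 : ∑ i, ∑ j, ‖Z i j‖ ^ 2 * (b i / (a j - a i)) =
      -∑ i, ∑ j, ‖Z i j‖ ^ 2 * (b j / (a j - a i)) := by
    rw [Finset.sum_comm, ← Finset.sum_neg_distrib]
    refine Finset.sum_congr rfl fun i _ => ?_
    rw [← Finset.sum_neg_distrib]
    refine Finset.sum_congr rfl fun j _ => ?_
    rw [h2 j i, ← neg_sub (a j) (a i), div_neg]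
    ring
  rw [h3, Fintype.sum_prod_type]
  simp only [sub_div, mul_sub, Finset.sum_sub_distrib, ← Finset.mul_sum]
  linarith

section

variable {n : ℕ} {ρd U : Matrix (Fin n) (Fin n) ℂ} {w : Fin n → ℝ}

/-- The parametrization of the isospectral set around `V diag(a) V†` by the Hermitian matrices
with zero diagonal. -/
noncomputable def orbitMap {a : Fin n → ℝ}
    (ha : ∀ T ∈ unitaryGroup (Fin n) ℂ,
      T * diagonal (fun k => (a k : ℂ)) * Tᴴ ∈ isospectralSet ρd)
    {V : Matrix (Fin n) (Fin n) ℂ} (hV : V ∈ unitaryGroup (Fin n) ℂ)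
    (Z : offDiagHermitian n) : isospectralSet ρd :=
  ⟨V * flattening a (Z : Matrix (Fin n) (Fin n) ℂ) * Vᴴ, by
    rw [unitary_conj_flattening, offDiagHermitianProj_apply_coe, sub_self, add_zero]
    exact ha _ (mul_mem hV (exp_mem_unitaryGroup (conjTranspose_divDiff a Z.2)))⟩

section

variable {a : Fin n → ℝ} (ha : ∀ T ∈ unitaryGroup (Fin n) ℂ,
    T * diagonal (fun k => (a k : ℂ)) * Tᴴ ∈ isospectralSet ρd)
  {V : Matrix (Fin n) (Fin n) ℂ} (hV : V ∈ unitaryGroup (Fin n) ℂ)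

theorem coe_orbitMap (Z : offDiagHermitian n) :
    (orbitMap ha hV Z : Matrix (Fin n) (Fin n) ℂ) =
      V * (NormedSpace.exp (divDiff a Z.1) * diagonal (fun k => (a k : ℂ)) *
        NormedSpace.exp (-divDiff a Z.1)) * Vᴴ := by
  change V * flattening a Z.1 * Vᴴ = _
  rw [flattening, offDiagHermitianProj_apply_coe, sub_self, add_zero]

theorem coe_orbitMap_zero :
    (orbitMap ha hV 0 : Matrix (Fin n) (Fin n) ℂ) = V * diagonal (fun k => (a k : ℂ)) * Vᴴ := by
  rw [coe_orbitMap]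
  simp

theorem hasFDerivAt_coe_orbitMap (hai : Function.Injective a) :
    HasFDerivAt (Subtype.val ∘ orbitMap ha hV)
      ((unitaryConjEquiv hV).toContinuousLinearMap ∘L (offDiagHermitian n).subtypeL)
      0 := by
  have h1 : HasFDerivAt (flattening a) (ContinuousLinearMap.id ℝ (Matrix (Fin n) (Fin n) ℂ))
      ((offDiagHermitian n).subtypeL 0) := by
    rw [map_zero]; exact hasFDerivAt_flattening hai
  have h2 := h1.comp (0 : offDiagHermitian n) (offDiagHermitian n).subtypeL.hasFDerivAt
  rw [ContinuousLinearMap.id_comp] at h2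
  exact (unitaryConjEquiv hV).hasFDerivAt.comp (0 : offDiagHermitian n) h2

theorem contDiff_coe_orbitMap : ContDiff ℝ ω (Subtype.val ∘ orbitMap ha hV) :=
  (unitaryConjEquiv hV).contDiff.comp
    ((contDiff_flattening a).comp (offDiagHermitian n).subtypeL.contDiff)

theorem hasFDerivAt_overlap_orbitMap (hai : Function.Injective a) :
    HasFDerivAt (overlap ρd ∘ orbitMap ha hV) ((reTraceMul ρd) ∘L
      ((unitaryConjEquiv hV).toContinuousLinearMap ∘L (offDiagHermitian n).subtypeL))
      0 :=
  (reTraceMul ρd).hasFDerivAt.comp _ (hasFDerivAt_coe_orbitMap ha hV hai)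

theorem injective_fderiv_coe_orbitMap (hai : Function.Injective a) :
    Function.Injective (fderiv ℝ (Subtype.val ∘ orbitMap ha hV) 0) := by
  rw [(hasFDerivAt_coe_orbitMap ha hV hai).fderiv]
  exact (unitaryConjEquiv hV).injective.comp Subtype.val_injective

variable [ChartedSpace (EuclideanSpace ℝ (Fin (n ^ 2 - n))) (isospectralSet ρd)]

/-- A continuous map into the source of an immersion is smooth once its composite with the immersion
is. No particular atlas is used, so the argument covers every admissible smooth structure. -/
theorem contMDiff_orbitMap (hemb : IsSmoothEmbedding (𝓡 (n ^ 2 - n))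
      𝓘(ℝ, Matrix (Fin n) (Fin n) ℂ) ∞
      (Subtype.val : isospectralSet ρd → Matrix (Fin n) (Fin n) ℂ)) :
    ContMDiff 𝓘(ℝ, offDiagHermitian n) (𝓡 (n ^ 2 - n)) ∞ (orbitMap ha hV) := by
  have h := contDiff_coe_orbitMap ha hV
  rw [ContMDiff.iff_comp_isImmersion hemb.isImmersion]
  exact ⟨Topology.IsInducing.subtypeVal.continuous_iff.mpr h.continuous,
    (h.of_le le_top).contMDiff⟩

theorem contMDiff_overlap (hemb : IsSmoothEmbedding (𝓡 (n ^ 2 - n))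
      𝓘(ℝ, Matrix (Fin n) (Fin n) ℂ) ∞
      (Subtype.val : isospectralSet ρd → Matrix (Fin n) (Fin n) ℂ)) :
    ContMDiff (𝓡 (n ^ 2 - n)) 𝓘(ℝ, ℝ) ∞ (overlap ρd) :=
  (reTraceMul ρd).contMDiff.comp hemb.contMDiff

variable [IsManifold (𝓡 (n ^ 2 - n)) ∞ (isospectralSet ρd)]

theorem isCriticalPt_orbitMap_zero_iff_fderiv (hemb : IsSmoothEmbedding (𝓡 (n ^ 2 - n))
      𝓘(ℝ, Matrix (Fin n) (Fin n) ℂ) ∞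
      (Subtype.val : isospectralSet ρd → Matrix (Fin n) (Fin n) ℂ))
    (hai : Function.Injective a) :
    IsCriticalPt (n ^ 2 - n) (overlap ρd) (orbitMap ha hV 0) ↔
      fderiv ℝ (overlap ρd ∘ orbitMap ha hV) 0 = 0 :=
  (exists_equiv_chartHessian (finrank_offDiagHermitian n) (contMDiff_overlap hemb)
    hemb.contMDiff (contMDiff_orbitMap ha hV hemb)
    (injective_fderiv_coe_orbitMap ha hV hai)).1

/-- The derivative in the parametrization is `Z ↦ Re Tr(Z V†ρdV)` on the Hermitian matrices with
zero diagonal. -/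
theorem isCriticalPt_orbitMap_zero_iff (hemb : IsSmoothEmbedding (𝓡 (n ^ 2 - n))
      𝓘(ℝ, Matrix (Fin n) (Fin n) ℂ) ∞
      (Subtype.val : isospectralSet ρd → Matrix (Fin n) (Fin n) ℂ))
    (hd : IsDensityMatrix ρd) (hai : Function.Injective a) :
    IsCriticalPt (n ^ 2 - n) (overlap ρd) (orbitMap ha hV 0) ↔ (Vᴴ * ρd * V).IsDiag := by
  have hB : (Vᴴ * ρd * V)ᴴ = Vᴴ * ρd * V := by
    rw [conjTranspose_mul, conjTranspose_mul, conjTranspose_conjTranspose,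
      hd.posSemidef.isHermitian, Matrix.mul_assoc]
  rw [isCriticalPt_orbitMap_zero_iff_fderiv ha hV hemb hai,
    (hasFDerivAt_overlap_orbitMap ha hV hai).fderiv, isDiag_iff_forall_re_trace_mul hB]
  have h : ∀ Z : offDiagHermitian n, ((reTraceMul ρd) ∘L
      ((unitaryConjEquiv hV).toContinuousLinearMap ∘L
        (offDiagHermitian n).subtypeL)) Z = (Z.1 * (Vᴴ * ρd * V)).trace.re :=
    fun Z => reTraceMul_unitary_conj ρd V Z.1
  constructor
  · intro h1 Z hZ
    rw [← h ⟨Z, hZ⟩, h1]; rfl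
  · intro h1
    ext1 Z
    rw [h, h1 Z Z.2]; rfl

/-- Along `t ↦ t Z` the point is `V exp(tX) diag(a) exp(-tX) V†`, with second derivative `V [X, [X,
diag(a)]] V†` at zero. Since `[X, diag(a)] = Z`, the Hessian is the trace of `[X, Z] diag(b)`. -/
theorem exists_equiv_chartHessian_overlap (hemb : IsSmoothEmbedding (𝓡 (n ^ 2 - n))
      𝓘(ℝ, Matrix (Fin n) (Fin n) ℂ) ∞
      (Subtype.val : isospectralSet ρd → Matrix (Fin n) (Fin n) ℂ))
    (hd : IsDensityMatrix ρd) (hai : Function.Injective a) {b : Fin n → ℝ}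
    (hb : Vᴴ * ρd * V = diagonal (fun k => (b k : ℂ))) :
    ∃ L : offDiagHermitian n ≃ₗ[ℝ] EuclideanSpace ℝ (Fin (n ^ 2 - n)), ∀ Z,
      chartHessian (n ^ 2 - n) (overlap ρd) (orbitMap ha hV 0) (L Z) (L Z) =
        -∑ p : Fin n × Fin n, ‖Z.1 p.1 p.2‖ ^ 2 * ((b p.2 - b p.1) / (a p.2 - a p.1)) := by
  have hcrit := (isCriticalPt_orbitMap_zero_iff ha hV hemb hd hai).mpr
    (hb ▸ isDiag_diagonal _)
  obtain ⟨L, hL⟩ := (exists_equiv_chartHessian (finrank_offDiagHermitian n)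
    (contMDiff_overlap hemb) hemb.contMDiff (contMDiff_orbitMap ha hV hemb)
    (injective_fderiv_coe_orbitMap ha hV hai)).2 hcrit
  refine ⟨L, fun Z => ?_⟩
  let ℓ := reTraceMul ρd ∘L (unitaryConjEquiv hV).toContinuousLinearMap
  have hℓ : ∀ A, ℓ A = (A * diagonal (fun k => (b k : ℂ))).trace.re := fun A => by
    rw [← hb]; exact reTraceMul_unitary_conj ρd V A
  let X := divDiff a Z.1
  have hd1 : ∀ (A : Matrix (Fin n) (Fin n) ℂ) (t : ℝ), HasDerivAt
      (fun t : ℝ => ℓ (NormedSpace.exp (t • X) * A * NormedSpace.exp (-(t • X))))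
      (ℓ (NormedSpace.exp (t • X) * (X * A - A * X) * NormedSpace.exp (-(t • X)))) t :=
    fun A t => ℓ.hasFDerivAt.comp_hasDerivAt t (hasDerivAt_exp_conj X A t)
  have hcomm : X * diagonal (fun k => (a k : ℂ)) - diagonal (fun k => (a k : ℂ)) * X = Z :=
    divDiff_commutator hai Z.2
  have h1 : (fun t : ℝ => overlap ρd (orbitMap ha hV (t • Z))) = fun t : ℝ =>
      ℓ (NormedSpace.exp (t • X) * diagonal (fun k => (a k : ℂ)) *
        NormedSpace.exp (-(t • X))) := by
    ext t
    rw [overlap_eq_reTraceMul, coe_orbitMap, Submodule.coe_smul, map_smul]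
    rfl
  -- The derivative formula is applied twice: to `diag(a)`, then to its commutator with `X`.
  have h2 := hL Z _ _ (fun t => by rw [h1]; exact hd1 _ t) (hd1 _ 0)
  rw [h2, hcomm, ← re_trace_commutator_divDiff a b Z.2, hℓ]
  simp [X]

end

end

/-! ### Orderings of the eigenvalues and diagonal quadratic forms -/

/-- Permutations are determined by the order in which they list distinct real numbers. -/
theorem perm_eq_of_mul_pos {n : ℕ} {w : Fin n → ℝ} (hw : Function.Injective w)
    {σ τ : Equiv.Perm (Fin n)}
    (h : ∀ i j, i ≠ j → 0 < (w (σ j) - w (σ i)) * (w (τ j) - w (τ i))) : σ = τ := by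
  have h1 : ∀ i j, w (σ i) < w (σ j) ↔ w (τ i) < w (τ j) := by
    intro i j
    by_cases hij : i = j
    · simp [hij]
    · have := h i j hij
      constructor <;> intro h2 <;> nlinarith
  -- The rank `c` determines an index, and `c (π i)` depends only on the order in which `w ∘ π`
  -- lists its values.
  let c : Fin n → ℕ := fun i => (Finset.univ.filter fun k => w k < w i).card
  have hc : ∀ (π : Equiv.Perm (Fin n)) i,
      c (π i) = (Finset.univ.filter fun k => w (π k) < w (π i)).card := by
    intro π i
    refine (Finset.card_bij (fun k _ => π k) ?_ ?_ ?_).symm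
    · intro k hk; simpa using hk
    · intro k _ l _ hkl; exact π.injective hkl
    · intro k hk; exact ⟨π.symm k, by simpa using hk, by simp⟩
  have hlt : ∀ i j, w i < w j → c i < c j := by
    intro i j hij
    refine Finset.card_lt_card (Finset.ssubset_iff_of_subset ?_ |>.mpr ⟨i, ?_, ?_⟩)
    · intro k hk
      simp only [Finset.mem_filter, Finset.mem_univ, true_and] at hk ⊢
      exact hk.trans hij
    · simpa using hij
    · simp
  have hci : Function.Injective c := by
    intro i j hij
    by_contra hne
    rcases lt_or_gt_of_ne (fun h' => hne (hw h')) with h2 | h2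
    · exact (hlt _ _ h2).ne hij
    · exact (hlt _ _ h2).ne' hij
  ext1 i
  apply hci
  rw [hc, hc]
  simp only [h1]

theorem sub_mul_sub_ne_zero {n : ℕ} {w : Fin n → ℝ} (hw : Function.Injective w)
    (τ : Equiv.Perm (Fin n)) {i j : Fin n} (hij : i ≠ j) :
    (w (τ j) - w (τ i)) * (w j - w i) ≠ 0 :=
  mul_ne_zero (sub_ne_zero.mpr fun h => hij (τ.injective (hw h)).symm)
    (sub_ne_zero.mpr fun h => hij (hw h).symm)

theorem perm_eq_of_forall_pos {n : ℕ} {w : Fin n → ℝ} (hw : Function.Injective w)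
    {σ τ : Equiv.Perm (Fin n)} (hσ : ∀ i j, i ≠ j → 0 < (w (σ j) - w (σ i)) * (w j - w i))
    (hτ : ∀ i j, i ≠ j → 0 < (w (τ j) - w (τ i)) * (w j - w i)) : σ = τ := by
  refine perm_eq_of_mul_pos hw fun i j hij => ?_
  have h1 := hσ i j hij
  have h2 := hτ i j hij
  rw [mul_pos_iff] at h1 h2 ⊢
  grind

theorem perm_eq_of_forall_neg {n : ℕ} {w : Fin n → ℝ} (hw : Function.Injective w)
    {σ τ : Equiv.Perm (Fin n)} (hσ : ∀ i j, i ≠ j → (w (σ j) - w (σ i)) * (w j - w i) < 0)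
    (hτ : ∀ i j, i ≠ j → (w (τ j) - w (τ i)) * (w j - w i) < 0) : σ = τ := by
  refine perm_eq_of_mul_pos hw fun i j hij => ?_
  have h1 := hσ i j hij
  have h2 := hτ i j hij
  rw [mul_neg_iff] at h1 h2
  rw [mul_pos_iff]
  grind

/-- Only two terms of the sum change. At an extremum the difference has a known sign, which reveals
whether `τ` keeps or reverses the order of the pair, as in the rearrangement inequality. -/
theorem sum_mul_sub_sum_swap {n : ℕ} (w : Fin n → ℝ) (τ : Equiv.Perm (Fin n)) {i j : Fin n}
    (hij : i ≠ j) :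
    ∑ k, w (τ k) * w k - ∑ k, w ((τ * Equiv.swap i j) k) * w k =
      (w (τ j) - w (τ i)) * (w j - w i) := by
  rw [← Finset.sum_sub_distrib, ← Finset.sum_subset (Finset.subset_univ {i, j}),
    Finset.sum_pair hij]
  · simp only [Equiv.Perm.mul_apply, Equiv.swap_apply_left, Equiv.swap_apply_right]
    ring
  · intro k _ hk
    simp only [Finset.mem_insert, Finset.mem_singleton, not_or] at hk
    rw [Equiv.Perm.mul_apply, Equiv.swap_apply_of_ne_of_ne hk.1 hk.2, sub_self]

/-- A real symmetric matrix with entry one at two positions. -/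
theorem exists_offDiagHermitian_support {n : ℕ} {i j : Fin n} (hij : i ≠ j) :
    ∃ Z : offDiagHermitian n, Z.1 i j ≠ 0 ∧
      ∀ k l, Z.1 k l ≠ 0 → k = i ∧ l = j ∨ k = j ∧ l = i := by
  refine ⟨⟨Matrix.of fun k l => if k = i ∧ l = j ∨ k = j ∧ l = i then 1 else 0, ?_, ?_⟩, ?_, ?_⟩
  · ext k l
    rw [conjTranspose_apply, of_apply, of_apply, apply_ite star, star_one, star_zero]
    congr 1
    grind
  · intro k
    rw [of_apply, if_neg]
    grind
  · simp
  · intro k l h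
    by_contra h'
    exact h (if_neg h')

/-- A matrix supported on `(i, j)` and `(j, i)` isolates the coefficient `r i j`. -/
theorem exists_sum_pos {n : ℕ} {r : Fin n → Fin n → ℝ} (hr : ∀ i j, r i j = r j i)
    {i j : Fin n} (hij : i ≠ j) (hpos : 0 < r i j) :
    ∃ Z : offDiagHermitian n, 0 < ∑ p : Fin n × Fin n, ‖Z.1 p.1 p.2‖ ^ 2 * r p.1 p.2 := by
  obtain ⟨Z, h1, h2⟩ := exists_offDiagHermitian_support hij
  refine ⟨Z, Finset.sum_pos' ?_ ⟨(i, j), Finset.mem_univ _, ?_⟩⟩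
  · intro p _
    by_cases h3 : Z.1 p.1 p.2 = 0
    · rw [h3]; simp
    · have : 0 < r p.1 p.2 := by
        rcases h2 _ _ h3 with h4 | h4
        · rw [h4.1, h4.2]; exact hpos
        · rw [h4.1, h4.2, hr]; exact hpos
      positivity
  · exact mul_pos (pow_pos (norm_pos_iff.mpr h1) 2) hpos

/-- A bilinear form that is diagonal with nonzero entries is nondegenerate. -/
theorem eq_zero_of_bilin_eq_zero {n : ℕ} {E : Type*} [NormedAddCommGroup E] [NormedSpace ℝ E]
    {B : E →L[ℝ] E →L[ℝ] ℝ} (hB : ∀ v v', B v v' = B v' v) {r : Fin n → Fin n → ℝ}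
    (hr : ∀ i j, r i j = r j i) (hr0 : ∀ i j, i ≠ j → r i j ≠ 0)
    (L : offDiagHermitian n ≃ₗ[ℝ] E)
    (hL : ∀ Z, B (L Z) (L Z) = -∑ p : Fin n × Fin n, ‖Z.1 p.1 p.2‖ ^ 2 * r p.1 p.2)
    {v : E} (hv : ∀ v', B v v' = 0) : v = 0 := by
  obtain ⟨Z, rfl⟩ := L.surjective v
  -- The test vector scales each entry of `Z` by its coefficient, so that pairing it with `Z` gives
  -- a sum of squares; symmetry of `r` keeps it Hermitian.
  let Y : offDiagHermitian n := ⟨Matrix.of fun i j => (r i j : ℂ) * Z.1 i j, by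
    constructor
    · ext i j
      rw [conjTranspose_apply, of_apply, of_apply, star_mul', offDiagHermitian_apply_symm Z.2,
        hr j i]
      simp
    · intro i
      rw [of_apply, Z.2.2, mul_zero]⟩
  have hY : ∀ i j, Y.1 i j = (r i j : ℂ) * Z.1 i j := fun i j => rfl
  -- Polarization recovers `4 B(Z, Y)` from the quadratic form, the only data in `hL`; entrywise it
  -- rests on `(1 + r)² - (1 - r)² = 4 r`.
  have h1 : B (L (Z + Y)) (L (Z + Y)) - B (L (Z - Y)) (L (Z - Y)) = 0 := by
    have h2 := hv (L Y)
    have h3 := hB (L Z) (L Y)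
    simp only [map_add, map_sub, _root_.add_apply, _root_.sub_apply]
    rw [← h3, h2]
    ring
  rw [hL, hL] at h1
  have h4 : ∑ p : Fin n × Fin n, 4 * (‖Z.1 p.1 p.2‖ ^ 2 * r p.1 p.2 ^ 2) = 0 := by
    rw [← neg_eq_zero, ← h1, neg_sub_neg, ← neg_sub, ← Finset.sum_sub_distrib, neg_inj]
    refine Finset.sum_congr rfl fun p _ => ?_
    have h5 : (Z + Y).1 p.1 p.2 = ((1 + r p.1 p.2 : ℝ) : ℂ) * Z.1 p.1 p.2 := by
      change Z.1 p.1 p.2 + Y.1 p.1 p.2 = _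
      rw [hY]; push_cast; ring
    have h6 : (Z - Y).1 p.1 p.2 = ((1 - r p.1 p.2 : ℝ) : ℂ) * Z.1 p.1 p.2 := by
      change Z.1 p.1 p.2 - Y.1 p.1 p.2 = _
      rw [hY]; push_cast; ring
    rw [h5, h6, norm_mul, norm_mul, Complex.norm_real, Complex.norm_real, mul_pow, mul_pow,
      Real.norm_eq_abs, Real.norm_eq_abs, sq_abs, sq_abs]
    ring
  rw [Finset.sum_eq_zero_iff_of_nonneg (fun _ _ => by positivity)] at h4
  have h7 : Z = 0 := by
    ext i j
    by_cases hij : i = j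
    · subst hij; exact Z.2.2 i
    · have := h4 (i, j) (Finset.mem_univ _)
      simpa [hr0 i j hij] using this
  rw [h7, map_zero]

/-! ### Critical points and the signs of their Hessians -/

section

variable {n : ℕ} {ρd U : Matrix (Fin n) (Fin n) ℂ} {w : Fin n → ℝ}

theorem conj_diagonal_perm_injective (hU : U ∈ unitaryGroup (Fin n) ℂ)
    (hwi : Function.Injective w) :
    Function.Injective (fun τ : Equiv.Perm (Fin n) =>
      U * diagonal (fun k => (w (τ k) : ℂ)) * Uᴴ) := by
  intro σ τ h
  have h1 := diagonal_injective ((unitaryConjEquiv hU).injective h)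
  ext1 i
  exact hwi (Complex.ofReal_injective (congrFun h1 i))

theorem conjTranspose_mul_mul_eq_diagonal (hU : U ∈ unitaryGroup (Fin n) ℂ)
    (hw : ρd = U * diagonal (fun k => (w k : ℂ)) * Uᴴ) :
    Uᴴ * ρd * U = diagonal (fun k => (w k : ℂ)) := by
  rw [hw]
  exact (unitaryConjEquiv hU).symm_apply_apply _

/-- The point `U diag(w ∘ τ) U†` of the isospectral set. -/
def permPoint (hd : IsDensityMatrix ρd) (hU : U ∈ unitaryGroup (Fin n) ℂ)
    (hw : ρd = U * diagonal (fun k => (w k : ℂ)) * Uᴴ) (τ : Equiv.Perm (Fin n)) :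
    isospectralSet ρd :=
  ⟨U * diagonal (fun k => (w (τ k) : ℂ)) * Uᴴ, conj_diagonal_mem_isospectralSet hd hU hw τ hU⟩

theorem permPoint_injective (hd : IsDensityMatrix ρd) (hU : U ∈ unitaryGroup (Fin n) ℂ)
    (hw : ρd = U * diagonal (fun k => (w k : ℂ)) * Uᴴ) (hwi : Function.Injective w) :
    Function.Injective (permPoint hd hU hw) :=
  fun _ _ h => conj_diagonal_perm_injective hU hwi (congrArg Subtype.val h)

theorem overlap_permPoint (hd : IsDensityMatrix ρd) (hU : U ∈ unitaryGroup (Fin n) ℂ)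
    (hw : ρd = U * diagonal (fun k => (w k : ℂ)) * Uᴴ) (τ : Equiv.Perm (Fin n)) :
    overlap ρd (permPoint hd hU hw τ) = ∑ k, w (τ k) * w k := by
  rw [overlap_eq_reTraceMul]
  change reTraceMul ρd (U * diagonal (fun k => (w (τ k) : ℂ)) * Uᴴ) = _
  rw [reTraceMul_unitary_conj, conjTranspose_mul_mul_eq_diagonal hU hw, diagonal_mul_diagonal,
    trace_diagonal, Complex.re_sum]
  refine Finset.sum_congr rfl fun k _ => ?_
  rw [← Complex.ofReal_mul, Complex.ofReal_re]

theorem permPoint_eq_orbitMap (hd : IsDensityMatrix ρd) (hU : U ∈ unitaryGroup (Fin n) ℂ)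
    (hw : ρd = U * diagonal (fun k => (w k : ℂ)) * Uᴴ) (τ : Equiv.Perm (Fin n)) :
    permPoint hd hU hw τ = orbitMap (a := w ∘ τ)
      (fun _ hT => conj_diagonal_mem_isospectralSet hd hU hw τ hT) hU 0 :=
  Subtype.ext (coe_orbitMap_zero _ _).symm

variable [ChartedSpace (EuclideanSpace ℝ (Fin (n ^ 2 - n))) (isospectralSet ρd)]
  [IsManifold (𝓡 (n ^ 2 - n)) ∞ (isospectralSet ρd)]

/-- If `V†ρdV` is diagonal, then `ρ = V D V†` commutes with `ρd`. As `ρd` has distinct eigenvalues,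
`U†ρU` is diagonal, and equality of spectra makes its diagonal a permutation of `w`. -/
theorem isCriticalPt_overlap_iff (hemb : IsSmoothEmbedding (𝓡 (n ^ 2 - n))
      𝓘(ℝ, Matrix (Fin n) (Fin n) ℂ) ∞
      (Subtype.val : isospectralSet ρd → Matrix (Fin n) (Fin n) ℂ))
    (hd : IsDensityMatrix ρd) (hU : U ∈ unitaryGroup (Fin n) ℂ)
    (hw : ρd = U * diagonal (fun k => (w k : ℂ)) * Uᴴ) (hwi : Function.Injective w)
    (ρ : isospectralSet ρd) :
    IsCriticalPt (n ^ 2 - n) (overlap ρd) ρ ↔ ∃ τ, permPoint hd hU hw τ = ρ := by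
  constructor
  · intro h
    obtain ⟨V, hV, hρ⟩ := exists_unitary_of_mem_isospectralSet hU hw hwi ρ.2
    have ha : ∀ T ∈ unitaryGroup (Fin n) ℂ,
        T * diagonal (fun k => (w k : ℂ)) * Tᴴ ∈ isospectralSet ρd :=
      fun _ hT => conj_diagonal_mem_isospectralSet hd hU hw 1 hT
    have hρ' : ρ = orbitMap ha hV 0 := Subtype.ext (hρ.trans (coe_orbitMap_zero _ _).symm)
    rw [hρ', isCriticalPt_orbitMap_zero_iff _ hV hemb hd hwi] at h
    have h1 : Vᴴ * ρd * V * diagonal (fun k => (w k : ℂ)) =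
        diagonal (fun k => (w k : ℂ)) * (Vᴴ * ρd * V) := by
      rw [← h.diagonal_diag, diagonal_mul_diagonal, diagonal_mul_diagonal]
      simp only [mul_comm]
    have hV2 : V * Vᴴ = 1 := Matrix.mem_unitaryGroup_iff.mp hV
    have h2 : ρd * ρ.1 = ρ.1 * ρd := by
      calc ρd * ρ.1 = (V * Vᴴ) * ρd * (V * diagonal (fun k => (w k : ℂ)) * Vᴴ) := by
            rw [hV2, Matrix.one_mul, ← hρ]
        _ = V * (Vᴴ * ρd * V * diagonal (fun k => (w k : ℂ))) * Vᴴ := by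
            simp only [Matrix.mul_assoc]
        _ = (V * diagonal (fun k => (w k : ℂ)) * Vᴴ) * ρd * (V * Vᴴ) := by
            rw [h1]; simp only [Matrix.mul_assoc]
        _ = ρ.1 * ρd := by rw [hV2, Matrix.mul_one, ← hρ]
    have hU2 : U * Uᴴ = 1 := Matrix.mem_unitaryGroup_iff.mp hU
    have h3 : (Uᴴ * ρ.1 * U).IsDiag := by
      apply isDiag_of_mul_diagonal_comm hwi
      rw [← conjTranspose_mul_mul_eq_diagonal hU hw]
      calc Uᴴ * ρ.1 * U * (Uᴴ * ρd * U) = Uᴴ * ρ.1 * (U * Uᴴ) * ρd * U := by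
            simp only [Matrix.mul_assoc]
        _ = Uᴴ * (ρ.1 * ρd) * U := by
            rw [hU2, Matrix.mul_one]; simp only [Matrix.mul_assoc]
        _ = Uᴴ * ρd * (U * Uᴴ) * ρ.1 * U := by
            rw [← h2, hU2, Matrix.mul_one]; simp only [Matrix.mul_assoc]
        _ = Uᴴ * ρd * U * (Uᴴ * ρ.1 * U) := by simp only [Matrix.mul_assoc]
    have hH : (Uᴴ * ρ.1 * U)ᴴ = Uᴴ * ρ.1 * U := by
      rw [conjTranspose_mul, conjTranspose_mul, conjTranspose_conjTranspose,
        ρ.2.1.posSemidef.isHermitian, Matrix.mul_assoc]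
    have h4 : Uᴴ * ρ.1 * U = diagonal (fun k => (((Uᴴ * ρ.1 * U) k k).re : ℂ)) := by
      conv_lhs => rw [← h3.diagonal_diag]
      congr 1
      ext k
      rw [diag_apply]
      have h5 : star ((Uᴴ * ρ.1 * U) k k) = (Uᴴ * ρ.1 * U) k k := by
        rw [← conjTranspose_apply, hH]
      exact (Complex.conj_eq_iff_re.mp h5).symm
    obtain ⟨c, hc⟩ : ∃ c : Fin n → ℝ, ρ.1 = U * diagonal (fun k => (c k : ℂ)) * Uᴴ :=
      ⟨_, by rw [← h4]; exact ((unitaryConjEquiv hU).apply_symm_apply ρ.1).symm⟩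
    obtain ⟨τ, rfl⟩ := exists_perm_of_conj_diagonal_mem hU hw hwi hU (hc ▸ ρ.2)
    exact ⟨τ, Subtype.ext hc.symm⟩
  · rintro ⟨τ, rfl⟩
    rw [permPoint_eq_orbitMap, isCriticalPt_orbitMap_zero_iff _ hU hemb hd (hwi.comp τ.injective),
      conjTranspose_mul_mul_eq_diagonal hU hw]
    exact isDiag_diagonal _

theorem exists_equiv_chartHessian_permPoint (hemb : IsSmoothEmbedding (𝓡 (n ^ 2 - n))
      𝓘(ℝ, Matrix (Fin n) (Fin n) ℂ) ∞
      (Subtype.val : isospectralSet ρd → Matrix (Fin n) (Fin n) ℂ))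
    (hd : IsDensityMatrix ρd) (hU : U ∈ unitaryGroup (Fin n) ℂ)
    (hw : ρd = U * diagonal (fun k => (w k : ℂ)) * Uᴴ) (hwi : Function.Injective w)
    (τ : Equiv.Perm (Fin n)) :
    ∃ L : offDiagHermitian n ≃ₗ[ℝ] EuclideanSpace ℝ (Fin (n ^ 2 - n)), ∀ Z,
      chartHessian (n ^ 2 - n) (overlap ρd) (permPoint hd hU hw τ) (L Z) (L Z) =
        -∑ p : Fin n × Fin n, ‖Z.1 p.1 p.2‖ ^ 2 *
          ((w p.2 - w p.1) / (w (τ p.2) - w (τ p.1))) := by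
  rw [permPoint_eq_orbitMap]
  exact exists_equiv_chartHessian_overlap _ hU hemb hd (hwi.comp τ.injective)
    (conjTranspose_mul_mul_eq_diagonal hU hw)

theorem isMorse_overlap (hemb : IsSmoothEmbedding (𝓡 (n ^ 2 - n))
      𝓘(ℝ, Matrix (Fin n) (Fin n) ℂ) ∞
      (Subtype.val : isospectralSet ρd → Matrix (Fin n) (Fin n) ℂ))
    (hd : IsDensityMatrix ρd) (hU : U ∈ unitaryGroup (Fin n) ℂ)
    (hw : ρd = U * diagonal (fun k => (w k : ℂ)) * Uᴴ) (hwi : Function.Injective w) :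
    IsMorse (n ^ 2 - n) (overlap ρd) := by
  refine ⟨contMDiff_overlap hemb, fun ρ hρ => ⟨hρ, fun v hv => ?_⟩⟩
  obtain ⟨τ, rfl⟩ := (isCriticalPt_overlap_iff hemb hd hU hw hwi ρ).mp hρ
  obtain ⟨L, hL⟩ := exists_equiv_chartHessian_permPoint hemb hd hU hw hwi τ
  refine eq_zero_of_bilin_eq_zero (chartHessian_symm (contMDiff_overlap hemb) _)
    (r := fun i j => (w j - w i) / (w (τ j) - w (τ i))) ?_ ?_ L hL hv
  · intro i j
    rw [← neg_sub, ← neg_sub (w (τ i)), neg_div_neg_eq]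
  · intro i j hij
    refine div_ne_zero (sub_ne_zero.mpr fun h => hij (hwi h).symm)
      (sub_ne_zero.mpr fun h => hij (τ.injective (hwi h)).symm)

/-- A pair kept in order has a positive coefficient in the sum, and the Hessian is minus that sum.
-/
theorem exists_chartHessian_neg (hemb : IsSmoothEmbedding (𝓡 (n ^ 2 - n))
      𝓘(ℝ, Matrix (Fin n) (Fin n) ℂ) ∞
      (Subtype.val : isospectralSet ρd → Matrix (Fin n) (Fin n) ℂ))
    (hd : IsDensityMatrix ρd) (hU : U ∈ unitaryGroup (Fin n) ℂ)
    (hw : ρd = U * diagonal (fun k => (w k : ℂ)) * Uᴴ) (hwi : Function.Injective w)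
    {τ : Equiv.Perm (Fin n)} {i j : Fin n} (hij : i ≠ j)
    (h : 0 < (w (τ j) - w (τ i)) * (w j - w i)) :
    ∃ v, chartHessian (n ^ 2 - n) (overlap ρd) (permPoint hd hU hw τ) v v < 0 := by
  obtain ⟨L, hL⟩ := exists_equiv_chartHessian_permPoint hemb hd hU hw hwi τ
  obtain ⟨Z, hZ⟩ := exists_sum_pos (r := fun i j => (w j - w i) / (w (τ j) - w (τ i)))
    (fun i j => by rw [← neg_sub, ← neg_sub (w (τ i)), neg_div_neg_eq]) hij
    (by rw [div_eq_mul_inv]; rw [mul_comm] at h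
        exact div_pos_iff.mpr (mul_pos_iff.mp h))
  exact ⟨L Z, by rw [hL]; linarith⟩

theorem exists_chartHessian_pos (hemb : IsSmoothEmbedding (𝓡 (n ^ 2 - n))
      𝓘(ℝ, Matrix (Fin n) (Fin n) ℂ) ∞
      (Subtype.val : isospectralSet ρd → Matrix (Fin n) (Fin n) ℂ))
    (hd : IsDensityMatrix ρd) (hU : U ∈ unitaryGroup (Fin n) ℂ)
    (hw : ρd = U * diagonal (fun k => (w k : ℂ)) * Uᴴ) (hwi : Function.Injective w)
    {τ : Equiv.Perm (Fin n)} {i j : Fin n} (hij : i ≠ j)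
    (h : (w (τ j) - w (τ i)) * (w j - w i) < 0) :
    ∃ v, 0 < chartHessian (n ^ 2 - n) (overlap ρd) (permPoint hd hU hw τ) v v := by
  obtain ⟨L, hL⟩ := exists_equiv_chartHessian_permPoint hemb hd hU hw hwi τ
  obtain ⟨Z, hZ⟩ := exists_sum_pos (r := fun i j => -((w j - w i) / (w (τ j) - w (τ i))))
    (fun i j => by rw [← neg_sub, ← neg_sub (w (τ i)), neg_div_neg_eq]) hij
    (by rw [mul_comm] at h
        exact neg_pos.mpr (div_neg_iff.mpr (mul_neg_iff.mp h)))
  refine ⟨L Z, ?_⟩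
  rw [hL]
  simpa only [mul_neg, Finset.sum_neg_distrib] using hZ

theorem chartHessian_nonpos (hemb : IsSmoothEmbedding (𝓡 (n ^ 2 - n))
      𝓘(ℝ, Matrix (Fin n) (Fin n) ℂ) ∞
      (Subtype.val : isospectralSet ρd → Matrix (Fin n) (Fin n) ℂ))
    (hd : IsDensityMatrix ρd) (hU : U ∈ unitaryGroup (Fin n) ℂ)
    (hw : ρd = U * diagonal (fun k => (w k : ℂ)) * Uᴴ) (hwi : Function.Injective w)
    {τ : Equiv.Perm (Fin n)} (h : ∀ i j, i ≠ j → 0 < (w (τ j) - w (τ i)) * (w j - w i))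
    (v : EuclideanSpace ℝ (Fin (n ^ 2 - n))) :
    chartHessian (n ^ 2 - n) (overlap ρd) (permPoint hd hU hw τ) v v ≤ 0 := by
  obtain ⟨L, hL⟩ := exists_equiv_chartHessian_permPoint hemb hd hU hw hwi τ
  obtain ⟨Z, rfl⟩ := L.surjective v
  rw [hL, neg_nonpos]
  refine Finset.sum_nonneg fun p _ => mul_nonneg (sq_nonneg _) ?_
  by_cases hp : p.1 = p.2
  · rw [hp]; simp
  · have h1 := h p.1 p.2 hp
    rw [mul_comm] at h1
    exact (div_pos_iff.mpr (mul_pos_iff.mp h1)).le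

theorem chartHessian_nonneg (hemb : IsSmoothEmbedding (𝓡 (n ^ 2 - n))
      𝓘(ℝ, Matrix (Fin n) (Fin n) ℂ) ∞
      (Subtype.val : isospectralSet ρd → Matrix (Fin n) (Fin n) ℂ))
    (hd : IsDensityMatrix ρd) (hU : U ∈ unitaryGroup (Fin n) ℂ)
    (hw : ρd = U * diagonal (fun k => (w k : ℂ)) * Uᴴ) (hwi : Function.Injective w)
    {τ : Equiv.Perm (Fin n)} (h : ∀ i j, i ≠ j → (w (τ j) - w (τ i)) * (w j - w i) < 0)
    (v : EuclideanSpace ℝ (Fin (n ^ 2 - n))) :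
    0 ≤ chartHessian (n ^ 2 - n) (overlap ρd) (permPoint hd hU hw τ) v v := by
  obtain ⟨L, hL⟩ := exists_equiv_chartHessian_permPoint hemb hd hU hw hwi τ
  obtain ⟨Z, rfl⟩ := L.surjective v
  rw [hL, neg_nonneg]
  refine Finset.sum_nonpos fun p _ => mul_nonpos_of_nonneg_of_nonpos (sq_nonneg _) ?_
  by_cases hp : p.1 = p.2
  · rw [hp]; simp
  · have h1 := h p.1 p.2 hp
    rw [mul_comm] at h1
    exact (div_neg_iff.mpr (mul_neg_iff.mp h1)).le

/-- A global extremum pulls back along the parametrization to an extremum on a vector space, where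
the derivative vanishes. -/
theorem isCriticalPt_of_isExtrOn (hemb : IsSmoothEmbedding (𝓡 (n ^ 2 - n))
      𝓘(ℝ, Matrix (Fin n) (Fin n) ℂ) ∞
      (Subtype.val : isospectralSet ρd → Matrix (Fin n) (Fin n) ℂ))
    (hd : IsDensityMatrix ρd) (hU : U ∈ unitaryGroup (Fin n) ℂ)
    (hw : ρd = U * diagonal (fun k => (w k : ℂ)) * Uᴴ) (hwi : Function.Injective w)
    {ρ : isospectralSet ρd} (h : IsExtrOn (overlap ρd) Set.univ ρ) :
    IsCriticalPt (n ^ 2 - n) (overlap ρd) ρ := by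
  obtain ⟨V, hV, hρ⟩ := exists_unitary_of_mem_isospectralSet hU hw hwi ρ.2
  have ha : ∀ T ∈ unitaryGroup (Fin n) ℂ,
      T * diagonal (fun k => (w k : ℂ)) * Tᴴ ∈ isospectralSet ρd :=
    fun _ hT => conj_diagonal_mem_isospectralSet hd hU hw 1 hT
  have hρ' : ρ = orbitMap ha hV 0 := Subtype.ext (hρ.trans (coe_orbitMap_zero _ _).symm)
  rw [hρ'] at h ⊢
  rw [isCriticalPt_orbitMap_zero_iff_fderiv _ hV hemb hwi]
  refine IsLocalExtr.fderiv_eq_zero ?_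
  rcases h with h | h
  · exact Or.inl (Filter.Eventually.of_forall fun Z => h (Set.mem_univ _))
  · exact Or.inr (Filter.Eventually.of_forall fun Z => h (Set.mem_univ _))

end

/-! ### Number of critical points and the two extrema -/

section

variable {n : ℕ} {ρd U : Matrix (Fin n) (Fin n) ℂ} {w : Fin n → ℝ}
  [ChartedSpace (EuclideanSpace ℝ (Fin (n ^ 2 - n))) (isospectralSet ρd)]
  [IsManifold (𝓡 (n ^ 2 - n)) ∞ (isospectralSet ρd)]

theorem setOf_isCriticalPt_overlap (hemb : IsSmoothEmbedding (𝓡 (n ^ 2 - n))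
      𝓘(ℝ, Matrix (Fin n) (Fin n) ℂ) ∞
      (Subtype.val : isospectralSet ρd → Matrix (Fin n) (Fin n) ℂ))
    (hd : IsDensityMatrix ρd) (hU : U ∈ unitaryGroup (Fin n) ℂ)
    (hw : ρd = U * diagonal (fun k => (w k : ℂ)) * Uᴴ) (hwi : Function.Injective w) :
    {ρ : isospectralSet ρd | IsCriticalPt (n ^ 2 - n) (overlap ρd) ρ} =
      Set.range (permPoint hd hU hw) :=
  Set.ext fun ρ => isCriticalPt_overlap_iff hemb hd hU hw hwi ρ

theorem ncard_isCriticalPt_overlap (hemb : IsSmoothEmbedding (𝓡 (n ^ 2 - n))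
      𝓘(ℝ, Matrix (Fin n) (Fin n) ℂ) ∞
      (Subtype.val : isospectralSet ρd → Matrix (Fin n) (Fin n) ℂ))
    (hd : IsDensityMatrix ρd) (hU : U ∈ unitaryGroup (Fin n) ℂ)
    (hw : ρd = U * diagonal (fun k => (w k : ℂ)) * Uᴴ) (hwi : Function.Injective w) :
    {ρ : isospectralSet ρd | IsCriticalPt (n ^ 2 - n) (overlap ρd) ρ}.ncard = n.factorial := by
  rw [setOf_isCriticalPt_overlap hemb hd hU hw hwi, ← Set.image_univ,
    Set.ncard_image_of_injective _ (permPoint_injective hd hU hw hwi), Set.ncard_univ,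
    Nat.card_perm, Nat.card_fin]

/-- The maximum and the minimum of the overlap, as permutations of the eigenvalues. -/
theorem exists_perm_extrema (hemb : IsSmoothEmbedding (𝓡 (n ^ 2 - n))
      𝓘(ℝ, Matrix (Fin n) (Fin n) ℂ) ∞
      (Subtype.val : isospectralSet ρd → Matrix (Fin n) (Fin n) ℂ))
    (hd : IsDensityMatrix ρd) (hU : U ∈ unitaryGroup (Fin n) ℂ)
    (hw : ρd = U * diagonal (fun k => (w k : ℂ)) * Uᴴ) (hwi : Function.Injective w) :
    ∃ σ τ : Equiv.Perm (Fin n),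
      (∀ i j, i ≠ j → 0 < (w (σ j) - w (σ i)) * (w j - w i)) ∧
      (∀ i j, i ≠ j → (w (τ j) - w (τ i)) * (w j - w i) < 0) ∧
      (∀ ρ, ρ ≠ permPoint hd hU hw σ →
        overlap ρd ρ < overlap ρd (permPoint hd hU hw σ)) ∧
      (∀ ρ, ρ ≠ permPoint hd hU hw τ →
        overlap ρd (permPoint hd hU hw τ) < overlap ρd ρ) := by
  have : CompactSpace (isospectralSet ρd) :=
    isCompact_iff_compactSpace.mp (isCompact_isospectralSet hd hU hw hwi)
  have hne : (Set.univ : Set (isospectralSet ρd)).Nonempty :=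
    ⟨permPoint hd hU hw 1, Set.mem_univ _⟩
  have hmax : ∀ ρ, IsMaxOn (overlap ρd) Set.univ ρ → ∃ σ, permPoint hd hU hw σ = ρ ∧
      ∀ i j, i ≠ j → 0 < (w (σ j) - w (σ i)) * (w j - w i) := by
    intro ρ hρ
    obtain ⟨σ, rfl⟩ := (isCriticalPt_overlap_iff hemb hd hU hw hwi ρ).mp
      (isCriticalPt_of_isExtrOn hemb hd hU hw hwi (Or.inr hρ))
    refine ⟨σ, rfl, fun i j hij => lt_of_le_of_ne ?_ (sub_mul_sub_ne_zero hwi σ hij).symm⟩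
    -- The product is the gap between the maximum and the value at `σ` composed with the
    -- transposition of `i` and `j`.
    rw [← sum_mul_sub_sum_swap w σ hij, ← overlap_permPoint hd hU hw,
      ← overlap_permPoint hd hU hw, sub_nonneg]
    exact hρ (Set.mem_univ _)
  have hmin : ∀ ρ, IsMinOn (overlap ρd) Set.univ ρ → ∃ τ, permPoint hd hU hw τ = ρ ∧
      ∀ i j, i ≠ j → (w (τ j) - w (τ i)) * (w j - w i) < 0 := by
    intro ρ hρ
    obtain ⟨τ, rfl⟩ := (isCriticalPt_overlap_iff hemb hd hU hw hwi ρ).mp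
      (isCriticalPt_of_isExtrOn hemb hd hU hw hwi (Or.inl hρ))
    refine ⟨τ, rfl, fun i j hij => lt_of_le_of_ne ?_ (sub_mul_sub_ne_zero hwi τ hij)⟩
    rw [← sum_mul_sub_sum_swap w τ hij, ← overlap_permPoint hd hU hw,
      ← overlap_permPoint hd hU hw, sub_nonpos]
    exact hρ (Set.mem_univ _)
  obtain ⟨x, -, hx⟩ := isCompact_univ.exists_isMaxOn hne (continuous_overlap ρd).continuousOn
  obtain ⟨y, -, hy⟩ := isCompact_univ.exists_isMinOn hne (continuous_overlap ρd).continuousOn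
  obtain ⟨σ, rfl, hσ⟩ := hmax x hx
  obtain ⟨τ, rfl, hτ⟩ := hmin y hy
  refine ⟨σ, τ, hσ, hτ, fun ρ hρ => lt_of_le_of_ne (hx (Set.mem_univ ρ)) fun h => hρ ?_,
    fun ρ hρ => lt_of_le_of_ne (hy (Set.mem_univ ρ)) fun h => hρ ?_⟩
  -- A point with the maximal value is again a maximum, so its permutation also keeps every pair in
  -- order and equals `σ`; hence strictness.
  · obtain ⟨σ', rfl, hσ'⟩ := hmax ρ fun ρ' h' => by
      rw [Set.mem_ofPred_eq, h]; exact hx h'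
    congr 1
    exact perm_eq_of_forall_pos hwi hσ' hσ
  · obtain ⟨τ', rfl, hτ'⟩ := hmin ρ fun ρ' h' => by
      rw [Set.mem_ofPred_eq, ← h]; exact hy h'
    congr 1
    exact perm_eq_of_forall_neg hwi hτ' hτ

end

/-! ### Assembly and the count of saddles -/

theorem mainTheorem2 {n : ℕ} (hn : 2 ≤ n) (ρd : Matrix (Fin n) (Fin n) ℂ)
    (hρd : IsGenericState ρd) :
    IsCompact (isospectralSet ρd) ∧
    Nonempty ((Matrix.unitaryGroup (Fin n) ℂ ⧸ diagonalTorus n) ≃ₜ isospectralSet ρd) ∧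
    (∃ _ : ChartedSpace (EuclideanSpace ℝ (Fin (n ^ 2 - n))) (isospectralSet ρd),
      IsManifold (𝓡 (n ^ 2 - n)) ∞ (isospectralSet ρd) ∧
      IsSmoothEmbedding (𝓡 (n ^ 2 - n)) 𝓘(ℝ, Matrix (Fin n) (Fin n) ℂ) ∞
        (Subtype.val : isospectralSet ρd → Matrix (Fin n) (Fin n) ℂ)) ∧
    ∀ [ChartedSpace (EuclideanSpace ℝ (Fin (n ^ 2 - n))) (isospectralSet ρd)]
      [IsManifold (𝓡 (n ^ 2 - n)) ∞ (isospectralSet ρd)],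
      IsSmoothEmbedding (𝓡 (n ^ 2 - n)) 𝓘(ℝ, Matrix (Fin n) (Fin n) ℂ) ∞
        (Subtype.val : isospectralSet ρd → Matrix (Fin n) (Fin n) ℂ) →
      IsMorse (n ^ 2 - n) (overlap ρd) ∧
      {ρ : isospectralSet ρd | IsCriticalPt (n ^ 2 - n) (overlap ρd) ρ}.ncard = n.factorial ∧
      (∀ U ∈ Matrix.unitaryGroup (Fin n) ℂ, ∀ w : Fin n → ℝ,
        ρd = U * Matrix.diagonal (fun k => (w k : ℂ)) * Uᴴ →
        Function.Injective (fun τ : Equiv.Perm (Fin n) =>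
          U * Matrix.diagonal (fun k => (w (τ k) : ℂ)) * Uᴴ) ∧
        Subtype.val '' {ρ : isospectralSet ρd | IsCriticalPt (n ^ 2 - n) (overlap ρd) ρ} =
          Set.range (fun τ : Equiv.Perm (Fin n) =>
            U * Matrix.diagonal (fun k => (w (τ k) : ℂ)) * Uᴴ)) ∧
      ∃ ρmax ρmin : isospectralSet ρd,
        ρmax ≠ ρmin ∧
        IsCriticalPt (n ^ 2 - n) (overlap ρd) ρmax ∧ IsCriticalPt (n ^ 2 - n) (overlap ρd) ρmin ∧
        (∀ ρ, ρ ≠ ρmax → overlap ρd ρ < overlap ρd ρmax) ∧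
        (∀ ρ, ρ ≠ ρmin → overlap ρd ρmin < overlap ρd ρ) ∧
        (∀ ρ₀, IsCriticalPt (n ^ 2 - n) (overlap ρd) ρ₀ → ρ₀ ≠ ρmax → ρ₀ ≠ ρmin →
          IsSaddle (n ^ 2 - n) (overlap ρd) ρ₀ ∧
          overlap ρd ρmin < overlap ρd ρ₀ ∧ overlap ρd ρ₀ < overlap ρd ρmax) ∧
        {ρ : isospectralSet ρd | IsSaddle (n ^ 2 - n) (overlap ρd) ρ}.ncard = n.factorial - 2 := by
  have hd := hρd.isDensityMatrix
  obtain ⟨U, hU, w, hw⟩ := hd.posSemidef.isHermitian.exists_unitary_diagonal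
  have hwi := hρd.injective hU hw
  refine ⟨isCompact_isospectralSet hd hU hw hwi, nonempty_homeomorph_isospectralSet hd hU hw hwi,
    exists_chartedSpace_of_isSliceChart (offDiagSplitting n)
      (exists_isSliceChart_isospectralSet hd hU hw hwi), ?_⟩
  intro _ _ hemb
  have hmorse := isMorse_overlap hemb hd hU hw hwi
  have hcrit := isCriticalPt_overlap_iff hemb hd hU hw hwi
  have hcard := ncard_isCriticalPt_overlap hemb hd hU hw hwi
  refine ⟨hmorse, hcard, ?_, ?_⟩
  · intro U' hU' w' hw'
    have hwi' := hρd.injective hU' hw'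
    refine ⟨conj_diagonal_perm_injective hU' hwi', ?_⟩
    rw [setOf_isCriticalPt_overlap hemb hd hU' hw' hwi', ← Set.range_comp]
    rfl
  obtain ⟨σ, τ, hσ, hτ, hmax, hmin⟩ := exists_perm_extrema hemb hd hU hw hwi
  have hne : permPoint hd hU hw σ ≠ permPoint hd hU hw τ := by
    intro h
    -- With `n ≥ 2` there is a pair of distinct indices, and no permutation both keeps and reverses
    -- it.
    have h01 : (⟨0, by omega⟩ : Fin n) ≠ ⟨1, by omega⟩ := by simp
    have h1 := hσ _ _ h01
    rw [permPoint_injective hd hU hw hwi h] at h1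
    exact lt_asymm h1 (hτ _ _ h01)
  have hσc := (hcrit _).mpr ⟨σ, rfl⟩
  have hτc := (hcrit _).mpr ⟨τ, rfl⟩
  have hsaddle : ∀ ρ₀, IsCriticalPt (n ^ 2 - n) (overlap ρd) ρ₀ → ρ₀ ≠ permPoint hd hU hw σ →
      ρ₀ ≠ permPoint hd hU hw τ → IsSaddle (n ^ 2 - n) (overlap ρd) ρ₀ := by
    intro ρ₀ h0 h1 h2
    obtain ⟨π, rfl⟩ := (hcrit ρ₀).mp h0
    refine ⟨hmorse.2 _ h0, ?_, ?_⟩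
    -- Without a direction of positive curvature no pair is reversed, which forces `π = σ`; the
    -- other case is symmetric.
    · by_contra hcon
      refine h1 (congrArg _ (perm_eq_of_forall_pos hwi (fun i j hij => ?_) hσ))
      refine lt_of_le_of_ne (not_lt.mp fun h => hcon ?_) (sub_mul_sub_ne_zero hwi π hij).symm
      exact exists_chartHessian_pos hemb hd hU hw hwi hij h
    · by_contra hcon
      refine h2 (congrArg _ (perm_eq_of_forall_neg hwi (fun i j hij => ?_) hτ))
      refine lt_of_le_of_ne (not_lt.mp fun h => hcon ?_) (sub_mul_sub_ne_zero hwi π hij)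
      exact exists_chartHessian_neg hemb hd hU hw hwi hij h
  refine ⟨_, _, hne, hσc, hτc, hmax, hmin,
    fun ρ₀ h0 h1 h2 => ⟨hsaddle ρ₀ h0 h1 h2, hmin ρ₀ h2, hmax ρ₀ h1⟩, ?_⟩
  -- The Hessian is semidefinite at the two extrema, so neither is a saddle.
  have hset : {ρ : isospectralSet ρd | IsSaddle (n ^ 2 - n) (overlap ρd) ρ} =
      {ρ : isospectralSet ρd | IsCriticalPt (n ^ 2 - n) (overlap ρd) ρ} \
        {permPoint hd hU hw σ, permPoint hd hU hw τ} := by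
    ext ρ
    simp only [Set.mem_ofPred_eq, Set.mem_sdiff, Set.mem_insert_iff, Set.mem_singleton_iff, not_or]
    constructor
    · rintro ⟨h1, ⟨v, hv⟩, v', hv'⟩
      refine ⟨h1.1, ?_, ?_⟩
      · rintro rfl
        exact hv.not_ge (chartHessian_nonpos hemb hd hU hw hwi hσ v)
      · rintro rfl
        exact hv'.not_ge (chartHessian_nonneg hemb hd hU hw hwi hτ v')
    · rintro ⟨h1, h2, h3⟩
      exact hsaddle ρ h1 h2 h3
  rw [hset, Set.ncard_sdiff, hcard, Set.ncard_pair hne]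
  rintro ρ (rfl | rfl)
  · exact hσc
  · exact hτc
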